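/- **Model.** A ground UE is at the origin. UAVs hover at altitude $h\ge 0$; their ground projections form a homogeneous Poisson point process of density $\lambda>0$ on $\mathbb R^2$, so a UAV at horizontal distance $\rho$ is at distance $r=\sqrt{\rho^2+h^2}$ from the UE. Let $C\ge 0$ and $Y\in\mathbb R$. A UAV at distance $r$ is line-of-sight (state $L$) with probability $$p_L(r)=\frac1{1+C\exp\left[-Y\left(\arcsin\left(\tfrac hr\right)\tfrac{180}{\pi}-C\right)\right]}$$ and non-line-of-sight (state $N$) with probability $p_N(r)=1-p_L(r)$. A UAV in state $i\in\{L,N\}$ at distance $r$ has path gain $\ell_i(r)=C_i r^{-a_i}$ ($C_i,a_i>0$), and its fading $g$ is Nakagami$(m_i,\Omega_i)$ distributed ($m_i,\Omega_i>0$), that is, has density $\frac{2m_i^{m_i}}{\Gamma(m_i)\Omega_i^{m_i}}x^{2m_i-1}e^{-m_ix^2/\Omega_i}$ on $(0,\infty)$. Given all UAV positions, the pairs (state, fading) of the different UAVs are independent. The UE is served by the UAV with the maximum path gain, and the SNR of a link in state $i$ at distance $r$ with fading $g$ is $$\mathrm{SNR}=\frac{P_{\rm TX}\,\ell_i(r)\,G\,g}{\mathrm{NF}\cdot\sigma^2},\qquad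 G=\mathcal N_{\rm UAV}\cdot\mathcal N_{\rm UE},$$ where $P_{\rm TX},\mathrm{NF},\sigma>0$ and the numbers of antenna elements $\mathcal N_{\rm UAV},\mathcal N_{\rm UE}$ are positive integers. Let $P_{\rm cov}(\Gamma)$ be the probability that the SNR of the link to the serving UAV exceeds $\Gamma$. **Notation.** Let $i^*$ be the state opposite to $i$, $\hat p_i(\rho)=p_i(\sqrt{\rho^2+h^2})$, $b(r)=\sqrt{\max(r^2-h^2,0)}$, $A_i(r)=\left(\frac{C_{i^*}}{C_i}r^{a_i}\right)^{1/a_{i^*}}$, $$f_i(r)=2\pi\lambda\, r\,\hat p_i(b(r))\exp\left(-2\pi\lambda\int_0^{b(r)}\hat p_i(\rho)\rho\,d\rho\right),$$ $$\bar f_i(r)=\exp\left(-2\pi\lambda\int_0^{b(A_i(r))}\hat p_{i^*}(\rho)\rho\,d\rho\right)f_i(r).$$ **Theorem.** Almost surely exactly one UAV attains the maximum path gain, and for every threshold $\Gamma\ge 0$ (in linear scale) $$P_{\rm cov}(\Gamma)=\sum_{i\in\{L,N\}}\int_h^\infty\left(1-\frac{\int_0^{\Delta_i}t^{m_i-1}e^{-t}\,dt}{(m_i-1)!}\right)\bar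 f_i(r)\,dr,$$ where both integrands are integrable, $\Delta_i=\frac{m_i}{\Omega_i}\zeta_i(r)^2$, $\zeta_i(r)=\frac{\Gamma\,\mathrm{NF}\,\sigma^2}{P_{\rm TX}\,G\,C_i}r^{a_i}$, and $(m_i-1)!$ means $\Gamma(m_i)$, with $\Gamma(\cdot)$ the gamma function, if $m_i$ is not an integer. -/

import Mathlib

open MeasureTheory ProbabilityTheory

/-! ### Poisson point processes and independent markings -/

/-- The number of points of the sequence `X` that fall in `A`. -/
noncomputable def pointCount {Ω E : Type*} (X : ℕ → Ω → E) (A : Set E) (ω : Ω) : ℕ∞ :=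
  {n : ℕ | X n ω ∈ A}.encard

/-- The points `X 0, X 1, X 2, …` (in an arbitrary measurable enumeration) form a Poisson point
process with intensity measure `Λ`: the number of points in a measurable set `A` is Poisson with
mean `Λ A` (almost surely infinite if `Λ A = ∞`), and the numbers of points in finitely many
pairwise disjoint measurable sets are independent. A sequence of points can only represent a
process with almost surely infinitely many points, that is, `Λ` has infinite total mass. -/
structure IsPoissonPointProcess {Ω E : Type*} [MeasurableSpace Ω] [MeasurableSpace E]
    (X : ℕ → Ω → E) (Λ : Measure E) (P : Measure Ω) : Prop where
  measurable : ∀ n, Measurable (X n)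
  count_law : ∀ A : Set E, MeasurableSet A → Λ A ≠ ⊤ → ∀ k : ℕ,
    P {ω | pointCount X A ω = k} = poissonMeasure (Λ A).toNNReal {k}
  count_top : ∀ A : Set E, MeasurableSet A → Λ A = ⊤ → ∀ᵐ ω ∂P, pointCount X A ω = ⊤
  count_indep : ∀ (k : ℕ) (A : Fin k → Set E), (∀ j, MeasurableSet (A j)) →
    Pairwise (fun i j => Disjoint (A i) (A j)) →
    iIndepFun (fun j => pointCount X (A j)) P

/-- `Y` is an independent `K`-marking of the points `X`: conditionally on the whole sequence
of points, the marks `Y n` are independent and `Y n` has law `K (X n)`. -/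
structure IsIndependentMarking {Ω E M : Type*} [MeasurableSpace Ω] [MeasurableSpace E]
    [MeasurableSpace M] (X : ℕ → Ω → E) (Y : ℕ → Ω → M) (K : E → Measure M)
    (P : Measure Ω) : Prop where
  measurable : ∀ n, Measurable (Y n)
  cond_law : ∀ A : Set (ℕ → E), MeasurableSet A → ∀ (s : Finset ℕ) (B : ℕ → Set M),
    (∀ n, MeasurableSet (B n)) →
    P {ω | (fun n => X n ω) ∈ A ∧ ∀ n ∈ s, Y n ω ∈ B n} =
      ∫⁻ ω in {ω | (fun n => X n ω) ∈ A}, ∏ n ∈ s, K (X n ω) (B n) ∂P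

/-- The Nakagami distribution of shape `m` and spread `Ω`. -/
noncomputable def nakagamiMeasure (m Ω : ℝ) : Measure ℝ :=
  (volume.restrict (Set.Ioi 0)).withDensity fun x =>
    ENNReal.ofReal (2 * m ^ m / (Real.Gamma m * Ω ^ m) * x ^ (2 * m - 1)
      * Real.exp (-(m / Ω) * x ^ 2))

/-! ### The UAV network -/

/-- Propagation state of a link: line-of-sight or non-line-of-sight. -/
inductive LinkState
  | los
  | nlos
  deriving DecidableEq

instance : Fintype LinkState where
  elems := {.los, .nlos}
  complete := by intro i; cases i <;> simp

instance : MeasurableSpace LinkState := ⊤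

/-- The opposite propagation state `i*`. -/
def LinkState.opp : LinkState → LinkState
  | .los => .nlos
  | .nlos => .los

/-- The parameters of the model. -/
structure NetworkParams where
  /-- altitude of the UAVs -/
  h : ℝ
  h_nonneg : 0 ≤ h
  /-- density of UAVs in the plane -/
  lam : ℝ
  lam_pos : 0 < lam
  /-- first environment parameter of the LOS probability -/
  envC : ℝ
  envC_nonneg : 0 ≤ envC
  /-- second environment parameter of the LOS probability -/
  envY : ℝ
  /-- path gain at unit distance -/
  C : LinkState → ℝ
  C_pos : ∀ i, 0 < C i
  /-- path loss exponent -/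
  a : LinkState → ℝ
  a_pos : ∀ i, 0 < a i
  /-- Nakagami shape -/
  m : LinkState → ℝ
  m_pos : ∀ i, 0 < m i
  /-- Nakagami spread -/
  spread : LinkState → ℝ
  spread_pos : ∀ i, 0 < spread i
  /-- transmit power -/
  PTX : ℝ
  PTX_pos : 0 < PTX
  /-- number of antenna elements at the UAV -/
  nUAV : ℕ
  nUAV_pos : 0 < nUAV
  /-- number of antenna elements at the UE -/
  nUE : ℕ
  nUE_pos : 0 < nUE
  /-- noise figure (linear scale) -/
  NF : ℝ
  NF_pos : 0 < NF
  /-- the thermal noise power is `σ ^ 2` -/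
  σ : ℝ
  σ_pos : 0 < σ

namespace NetworkParams

variable (p : NetworkParams)

/-- The antenna gain `G`. -/
noncomputable def G : ℝ := p.nUAV * p.nUE

/-- Probability that a link of length `r` is in state `i`. -/
noncomputable def stateProb : LinkState → ℝ → ℝ
  | .los, r => 1 / (1 + p.envC *
      Real.exp (-p.envY * (Real.arcsin (p.h / r) * (180 / Real.pi) - p.envC)))
  | .nlos, r => 1 - 1 / (1 + p.envC *
      Real.exp (-p.envY * (Real.arcsin (p.h / r) * (180 / Real.pi) - p.envC)))

/-- The same probability as a function of the horizontal distance `ρ`. -/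
noncomputable def stateProbHor (i : LinkState) (ρ : ℝ) : ℝ :=
  p.stateProb i (√(ρ ^ 2 + p.h ^ 2))

/-- Distance from the UE at the origin of the ground plane to a UAV at altitude `h` whose
projection on the ground is `x`. -/
noncomputable def dist (x : EuclideanSpace ℝ (Fin 2)) : ℝ := √(‖x‖ ^ 2 + p.h ^ 2)

/-- Path gain `ℓ_i(r)`. -/
noncomputable def pathGain (i : LinkState) (r : ℝ) : ℝ := p.C i * r ^ (-p.a i)

/-- Law of the pair (propagation state, fading) for a UAV above `x`: the state is `i` with
probability `p_i`, and the fading is then Nakagami with the parameters of state `i`. -/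
noncomputable def markLaw (x : EuclideanSpace ℝ (Fin 2)) : Measure (LinkState × ℝ) :=
  ∑ i, ENNReal.ofReal (p.stateProb i (p.dist x)) •
    (Measure.dirac i).prod (nakagamiMeasure (p.m i) (p.spread i))

/-- The random UAV network: the UAVs' ground projections `pos n` form a homogeneous Poisson
point process of density `lam` on the plane, and given all positions, the pairs of
propagation state and fading of the UAVs are independent with law `markLaw`. -/
structure IsUAVNetwork {Ω : Type*} [MeasurableSpace Ω] (P : Measure Ω)
    (pos : ℕ → Ω → EuclideanSpace ℝ (Fin 2)) (state : ℕ → Ω → LinkState)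
    (fading : ℕ → Ω → ℝ) : Prop where
  poisson : IsPoissonPointProcess pos (ENNReal.ofReal p.lam • volume) P
  marking : IsIndependentMarking pos (fun n ω => (state n ω, fading n ω)) p.markLaw P

section Coverage

variable {Ω : Type*} (pos : ℕ → Ω → EuclideanSpace ℝ (Fin 2)) (state : ℕ → Ω → LinkState)
  (fading : ℕ → Ω → ℝ)

/-- Path gain between the UE and UAV `n`. -/
noncomputable def gainOf (n : ℕ) (ω : Ω) : ℝ :=
  p.pathGain (state n ω) (p.dist (pos n ω))

/-- UAV `n` offers the maximum path gain, that is, it serves the UE. -/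
def IsServing (n : ℕ) (ω : Ω) : Prop :=
  ∀ k, p.gainOf pos state k ω ≤ p.gainOf pos state n ω

/-- SNR of the link to UAV `n`. -/
noncomputable def snr (n : ℕ) (ω : Ω) : ℝ :=
  p.PTX * p.gainOf pos state n ω * p.G * fading n ω / (p.NF * p.σ ^ 2)

/-- Probability that the SNR of the link to the serving UAV exceeds `Γ`. -/
noncomputable def coverageProb [MeasurableSpace Ω] (P : Measure Ω) (Γ : ℝ) : ℝ :=
  P.real {ω | ∃ n, p.IsServing pos state n ω ∧ Γ < p.snr pos state fading n ω}

end Coverage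

/-! ### The functions in the coverage formula -/

/-- Horizontal distance `b(r)` of a UAV at distance `r`; it is `0` for `r ≤ h`. -/
noncomputable def b (r : ℝ) : ℝ := √(r ^ 2 - p.h ^ 2)

/-- `A_i(r)`: distance at which a link of the opposite state has the path gain `ℓ_i(r)`. -/
noncomputable def A (i : LinkState) (r : ℝ) : ℝ :=
  (p.C i.opp / p.C i * r ^ p.a i) ^ (1 / p.a i.opp)

/-- `f_i(r)`. -/
noncomputable def f (i : LinkState) (r : ℝ) : ℝ :=
  2 * Real.pi * p.lam * r * p.stateProbHor i (p.b r) *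
    Real.exp (-2 * Real.pi * p.lam * ∫ ρ in (0 : ℝ)..p.b r, p.stateProbHor i ρ * ρ)

/-- `f̄_i(r)`. -/
noncomputable def fbar (i : LinkState) (r : ℝ) : ℝ :=
  Real.exp (-2 * Real.pi * p.lam *
    ∫ ρ in (0 : ℝ)..p.b (p.A i r), p.stateProbHor i.opp ρ * ρ) * p.f i r

/-- `ζ_i(r)` for the threshold `Γ`. -/
noncomputable def ζ (Γ : ℝ) (i : LinkState) (r : ℝ) : ℝ :=
  Γ * (p.NF * p.σ ^ 2) / (p.PTX * p.G * p.C i) * r ^ p.a i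

/-- `Δ_i` at distance `r` for the threshold `Γ`. -/
noncomputable def Δ (Γ : ℝ) (i : LinkState) (r : ℝ) : ℝ :=
  p.m i / p.spread i * p.ζ Γ i r ^ 2

end NetworkParams

/-! Attach to each UAV its state and fading. The marked points behave like a Poisson process on
position × (state, fading) with intensity `groundIntensity ⊗ₘ markKernel`, but all that is needed of
this is its void probabilities: a bounded region `B` of marked points is empty with probability
exp(-intensity of `B`). They follow from the probability generating functional of the ground process
(`integral_pointProd`), applied to u(x) = probability that the mark of a point at x misses `B`; the
result is `IsIndependentMarking.measureReal_forall_notMem`. By differences, one region is avoided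
and a disjoint one hit with probability e^{-v}(1 - e^{-g}).

Let M(t) = `meanCountGain i t` be the mean number of UAVs with gain at least ℓ_i(t), and I(s,t) the
mean number of UAVs in state i at distance in (s,t] whose fading exceeds the threshold ζ_i. The
probability that the serving UAV is of the latter kind lies between e^{-M(t)} I(s,t) and e^{-M(s)}
I(s,t). The integral over (s,t] of the density of I times e^{-M} obeys the same bounds, and both
quantities are additive in the interval. Since I(s,t) = O(t-s), they differ on (s,t] by at most a
constant times (t-s) times an increment of a fixed function. Such errors vanish under refinement
(`nonpos_of_subadditive_of_le_mul`), so the two agree; neither M nor the density has to be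
continuous.

The same refinement principle excludes ties in the path gain, because a tie needs two points in
small regions. Letting the distance range grow to (h,∞), rewriting the Nakagami tail as an
incomplete gamma integral and adding the two states gives the formula. -/

open Filter Topology

/-! ### Independent markings: joint conditions on point and mark -/

section Marking

variable {Ω E M : Type*} [MeasurableSpace Ω] [MeasurableSpace E] [MeasurableSpace M]

/-- The marks of finitely many points satisfy prescribed joint conditions on point and mark. -/
theorem IsIndependentMarking.measure_forall_mem_mixed {X : ℕ → Ω → E} {Y : ℕ → Ω → M}
    {K : Kernel E M} [IsMarkovKernel K] {P : Measure Ω} [IsFiniteMeasure P]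
    (hX : ∀ n, Measurable (X n)) (hY : IsIndependentMarking X Y K P)
    (C : ℕ → Set (E × M)) (hC : ∀ n, MeasurableSet (C n)) (s : Finset ℕ) :
    ∀ (A : Set (ℕ → E)), MeasurableSet A → ∀ (t : Finset ℕ), Disjoint s t →
      ∀ B : ℕ → Set M, (∀ n, MeasurableSet (B n)) →
      P {ω | (fun n => X n ω) ∈ A ∧ (∀ n ∈ s, (X n ω, Y n ω) ∈ C n) ∧ ∀ n ∈ t, Y n ω ∈ B n} =
        ∫⁻ ω in {ω | (fun n => X n ω) ∈ A}, (∏ n ∈ s, K (X n ω) (Prod.mk (X n ω) ⁻¹' C n)) *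
          ∏ n ∈ t, K (X n ω) (B n) ∂P := by
  have hXm : Measurable fun ω n => X n ω := measurable_pi_iff.2 hX
  have hYm := hY.measurable
  -- Indices move one at a time from product conditions (`t`) to joint conditions (`s`). Keeping
  -- `A`, `t` and `B` general lets the induction hypothesis absorb a test rectangle `A₁ × B₁` for
  -- the new index: `A₁` enters `A`, and `B₁` becomes the mark condition at `a`.
  induction s using Finset.induction_on with
  | empty =>
    intro A hA t _ B hB
    simpa using hY.cond_law A hA t B hB
  | insert a s ha ih =>
    intro A hA t ht B hB
    obtain ⟨hat, hst⟩ := Finset.disjoint_insert_left.1 ht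
    set R : Set Ω := {ω | (fun n => X n ω) ∈ A ∧ (∀ n ∈ s, (X n ω, Y n ω) ∈ C n) ∧
      ∀ n ∈ t, Y n ω ∈ B n} with hR
    have hRm : MeasurableSet R := by
      have h1 : MeasurableSet (⋂ n ∈ s, (fun ω => (X n ω, Y n ω)) ⁻¹' C n) :=
        Finset.measurableSet_biInter s fun n _ => ((hX n).prodMk (hYm n)) (hC n)
      have h2 : MeasurableSet (⋂ n ∈ t, Y n ⁻¹' B n) :=
        Finset.measurableSet_biInter t fun n _ => hYm n (hB n)
      convert (hXm hA).inter (h1.inter h2) using 1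
      ext ω; simp [hR]
    set g : Ω → ENNReal := fun ω => (∏ n ∈ s, K (X n ω) (Prod.mk (X n ω) ⁻¹' C n)) *
      ∏ n ∈ t, K (X n ω) (B n) with hg
    have hgm : Measurable g := by
      refine .mul ?_ ?_
      · exact Finset.measurable_fun_prod _ fun n _ =>
          (Kernel.measurable_kernel_prodMk_left (κ := K) (hC n)).comp (hX n)
      · exact Finset.measurable_fun_prod _ fun n _ =>
          (K.measurable_coe (hB n)).comp (hX n)
    have hg1 : ∀ ω, g ω ≤ 1 := fun ω =>
      mul_le_one' (Finset.prod_le_one' fun _ _ => prob_le_one)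
        (Finset.prod_le_one' fun _ _ => prob_le_one)
    set μ₁ : Measure (E × M) := (P.restrict R).map (fun ω => (X a ω, Y a ω)) with hμ₁
    set μ₀ : Measure Ω := (P.restrict {ω | (fun n => X n ω) ∈ A}).withDensity g with hμ₀
    have hfin : IsFiniteMeasure μ₀ := by
      refine isFiniteMeasure_withDensity ((lintegral_mono hg1).trans_lt ?_).ne
      simp
    set μ₂ : Measure (E × M) := (μ₀.map (X a)) ⊗ₘ K with hμ₂
    have hμ₂a : ∀ D, MeasurableSet D → μ₂ D =
        ∫⁻ ω in {ω | (fun n => X n ω) ∈ A}, g ω * K (X a ω) (Prod.mk (X a ω) ⁻¹' D) ∂P := by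
      intro D hD
      rw [hμ₂, Measure.compProd_apply hD,
        lintegral_map (Kernel.measurable_kernel_prodMk_left hD) (hX a), hμ₀,
        lintegral_withDensity_eq_lintegral_mul _ hgm
          (g := fun ω => K (X a ω) (Prod.mk (X a ω) ⁻¹' D))
          ((Kernel.measurable_kernel_prodMk_left (κ := K) hD).comp (hX a))]
      rfl
    have hμ₁a : ∀ D, MeasurableSet D → μ₁ D = P {ω | (X a ω, Y a ω) ∈ D ∧ ω ∈ R} := by
      intro D hD
      rw [hμ₁, Measure.map_apply ((hX a).prodMk (hYm a)) hD,
        Measure.restrict_apply (((hX a).prodMk (hYm a)) hD)]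
      rfl
    -- Both are finite measures on `E × M`, so agreement on rectangles is enough; evaluating them at
    -- `C a` then completes the induction.
    have key : μ₁ = μ₂ := by
      refine Measure.ext_prod fun {A₁ B₁} hA₁ hB₁ => ?_
      rw [hμ₁a _ (hA₁.prod hB₁), hμ₂a _ (hA₁.prod hB₁)]
      have hA' : MeasurableSet (A ∩ {x : ℕ → E | x a ∈ A₁}) :=
        hA.inter (measurable_pi_apply a hA₁)
      have h := ih (A ∩ {x : ℕ → E | x a ∈ A₁}) hA' (insert a t)
        (Finset.disjoint_insert_right.2 ⟨ha, hst⟩) (Function.update B a B₁) (by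
          intro n
          by_cases hn : n = a
          · subst hn; simpa using hB₁
          · simpa [hn] using hB n)
      have e1 : ∀ n ∈ t, Function.update B a B₁ n = B n := fun n hn =>
        Function.update_of_ne (by rintro rfl; exact hat hn) _ _
      convert h using 1
      · congr 1
        ext ω
        simp only [hR, Set.mem_ofPred_eq, Set.mem_prod, Set.mem_inter_iff, Finset.mem_insert,
          forall_eq_or_imp, Function.update_self]
        have : (∀ n ∈ t, Y n ω ∈ Function.update B a B₁ n) ↔ ∀ n ∈ t, Y n ω ∈ B n :=
          forall₂_congr fun n hn => by rw [e1 n hn]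
        rw [this]; tauto
      · have hs : {ω | (fun n => X n ω) ∈ A ∩ {x : ℕ → E | x a ∈ A₁}} =
          {ω | X a ω ∈ A₁} ∩ {ω | (fun n => X n ω) ∈ A} := by
          ext ω; simp [and_comm]
        have hm : MeasurableSet {ω | X a ω ∈ A₁} := (hX a) hA₁
        rw [hs, ← Measure.restrict_restrict hm, ← lintegral_indicator hm]
        refine lintegral_congr fun ω => ?_
        have e2 : ∏ n ∈ t, K (X n ω) (Function.update B a B₁ n) = ∏ n ∈ t, K (X n ω) (B n) :=
          Finset.prod_congr rfl fun n hn => by rw [e1 n hn]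
        by_cases hω : X a ω ∈ A₁
        · rw [Set.indicator_of_mem (show ω ∈ {ω | X a ω ∈ A₁} from hω),
            Set.mk_preimage_prod_right hω, Finset.prod_insert hat, Function.update_self, e2]
          simp only [hg]; ring
        · rw [Set.indicator_of_notMem (show ω ∉ {ω | X a ω ∈ A₁} from hω),
            Set.mk_preimage_prod_right_eq_empty hω]
          simp
    have := hμ₁a (C a) (hC a)
    rw [key, hμ₂a _ (hC a)] at this
    convert this.symm using 1
    · congr 1
      ext ω
      simp only [hR, Set.mem_ofPred_eq, Finset.mem_insert, forall_eq_or_imp]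
      tauto
    · refine lintegral_congr fun ω => ?_
      rw [Finset.prod_insert ha]
      simp only [hg]; ring

theorem IsIndependentMarking.measure_forall_mem {X : ℕ → Ω → E} {Y : ℕ → Ω → M}
    {K : Kernel E M} [IsMarkovKernel K] {P : Measure Ω} [IsFiniteMeasure P]
    (hX : ∀ n, Measurable (X n)) (hY : IsIndependentMarking X Y K P)
    {C : Set (E × M)} (hC : MeasurableSet C) (s : Finset ℕ) :
    P {ω | ∀ n ∈ s, (X n ω, Y n ω) ∈ C} =
      ∫⁻ ω, ∏ n ∈ s, K (X n ω) (Prod.mk (X n ω) ⁻¹' C) ∂P := by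
  simpa using hY.measure_forall_mem_mixed hX (fun _ => C) (fun _ => hC) s Set.univ .univ ∅
    (Finset.disjoint_empty_right s) (fun _ => ∅) (fun _ => .empty)

end Marking

/-! ### Generating functional of a Poisson point process -/

theorem measurable_pointCount {Ω E : Type*} [MeasurableSpace Ω] [MeasurableSpace E]
    {X : ℕ → Ω → E} (hX : ∀ n, Measurable (X n)) {A : Set E} (hA : MeasurableSet A) :
    Measurable (pointCount X A) := by
  refine measurable_encard.comp (measurable_set_iff.2 fun n => ?_)
  exact measurableSet_setOfPred.1 (hX n hA)

theorem integral_pow_poissonMeasure (r : NNReal) (y : ℝ) :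
    ∫ n, y ^ n ∂(poissonMeasure r) = Real.exp (-(r * (1 - y))) := by
  rw [integral_poissonMeasure]
  have h := (NormedSpace.expSeries_div_hasSum_exp (𝔸 := ℝ) ((r : ℝ) * y)).mul_left (Real.exp (-r))
  rw [← Real.exp_eq_exp_ℝ, ← Real.exp_add] at h
  rw [show -((r : ℝ) * (1 - y)) = -r + r * y by ring, ← h.tsum_eq]
  refine tsum_congr fun n => ?_
  rw [mul_pow, smul_eq_mul]; ring

theorem Measurable.enat_toNat {Ω : Type*} [MeasurableSpace Ω] {c : Ω → ℕ∞} (hc : Measurable c) :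
    Measurable fun ω => (c ω).toNat :=
  (Measurable.of_discrete (f := ENat.toNat)).comp hc

/-- The product of `u` over the points of the sequence `X` that fall in `S`. -/
noncomputable def pointProd {Ω E : Type*} (X : ℕ → Ω → E) (S : Set E) (u : E → ℝ) (ω : Ω) : ℝ :=
  ∏ᶠ n ∈ {n | X n ω ∈ S}, u (X n ω)

theorem pointProd_eq {Ω E : Type*} {X : ℕ → Ω → E} {S : Set E} (u : E → ℝ) {ω : Ω}
    (hω : {n | X n ω ∈ S}.Finite) : pointProd X S u ω = ∏ n ∈ hω.toFinset, u (X n ω) :=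
  finprod_mem_eq_finite_toFinset_prod _ hω

/-- Grouping the points by the value of `f` expresses the product through the counts in the disjoint
level sets, which is all that the definition of a Poisson process controls. -/
theorem pointProd_eq_prod_pow_pointCount {Ω E : Type*} [MeasurableSpace E] {X : ℕ → Ω → E}
    {S : Set E} (f : SimpleFunc E ℝ) {ω : Ω} (hω : {n | X n ω ∈ S}.Finite) :
    pointProd X S f ω =
      ∏ y ∈ f.range, y ^ (pointCount X (S ∩ f ⁻¹' {y}) ω).toNat := by
  classical
  rw [pointProd_eq _ hω, ← Finset.prod_fiberwise_of_maps_to (s := hω.toFinset) (t := f.range)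
    (g := fun n => f (X n ω)) (fun n _ => f.mem_range_self _)]
  refine Finset.prod_congr rfl fun y _ => ?_
  rw [Finset.prod_congr rfl (g := fun _ => y) (fun n hn => (Finset.mem_filter.1 hn).2),
    Finset.prod_const]
  congr 1
  have : {n | X n ω ∈ S ∩ f ⁻¹' {y}} =
      ((hω.toFinset.filter fun n => f (X n ω) = y : Finset ℕ) : Set ℕ) := by
    ext n; simp
  rw [pointCount, this, Set.encard_coe_eq_coe_finsetCard, ENat.toNat_natCast]

namespace IsPoissonPointProcess

variable {Ω E : Type*} [MeasurableSpace Ω] [MeasurableSpace E]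
  {X : ℕ → Ω → E} {Λ : Measure E} {P : Measure Ω}

theorem ae_pointCount_ne_top [IsProbabilityMeasure P] (hX : IsPoissonPointProcess X Λ P)
    {A : Set E} (hA : MeasurableSet A) (hΛ : Λ A ≠ ⊤) : ∀ᵐ ω ∂P, pointCount X A ω ≠ ⊤ := by
  have hm := measurable_pointCount hX.measurable hA
  have hk : ∀ k : ℕ, MeasurableSet {ω | pointCount X A ω = k} := fun k =>
    hm (measurableSet_singleton (k : ℕ∞))
  have h1 : P (⋃ k : ℕ, {ω | pointCount X A ω = k}) = 1 := by
    rw [measure_iUnion _ hk]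
    · simp_rw [hX.count_law A hA hΛ]
      have := measure_iUnion (μ := poissonMeasure (Λ A).toNNReal) (f := fun k : ℕ => {k})
        (fun i j hij => by simpa using hij) (fun _ => measurableSet_singleton _)
      rw [← this, Set.iUnion_of_singleton, measure_univ]
    · intro i j hij
      refine Set.disjoint_left.2 fun ω hi hj => hij ?_
      have hi' : pointCount X A ω = i := hi
      have hj' : pointCount X A ω = j := hj
      exact_mod_cast hi'.symm.trans hj'
  have h2 : ∀ᵐ ω ∂P, ω ∈ ⋃ k : ℕ, {ω | pointCount X A ω = k} :=
    (prob_compl_eq_zero_iff (.iUnion hk)).2 h1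
  filter_upwards [h2] with ω hω
  obtain ⟨k, hk⟩ := Set.mem_iUnion.1 hω
  have hk' : pointCount X A ω = k := hk
  simp [hk']

theorem ae_finite [IsProbabilityMeasure P] (hX : IsPoissonPointProcess X Λ P)
    {A : Set E} (hA : MeasurableSet A) (hΛ : Λ A ≠ ⊤) : ∀ᵐ ω ∂P, {n | X n ω ∈ A}.Finite := by
  filter_upwards [hX.ae_pointCount_ne_top hA hΛ] with ω hω
  exact Set.encard_ne_top_iff.1 hω

theorem map_pointCount_toNat [IsProbabilityMeasure P] (hX : IsPoissonPointProcess X Λ P)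
    {A : Set E} (hA : MeasurableSet A) (hΛ : Λ A ≠ ⊤) :
    P.map (fun ω => (pointCount X A ω).toNat) = poissonMeasure (Λ A).toNNReal := by
  have hm := measurable_pointCount hX.measurable hA
  refine Measure.ext_of_singleton fun k => ?_
  rw [Measure.map_apply (hm.enat_toNat)
    (measurableSet_singleton k), ← hX.count_law A hA hΛ]
  refine measure_congr ?_
  filter_upwards [hX.ae_pointCount_ne_top hA hΛ] with ω hω
  obtain ⟨l, hl⟩ := ENat.ne_top_iff_exists.1 hω
  apply propext
  change (pointCount X A ω).toNat = k ↔ pointCount X A ω = k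
  rw [← hl]; simp

theorem integral_pow_pointCount [IsProbabilityMeasure P] (hX : IsPoissonPointProcess X Λ P)
    {A : Set E} (hA : MeasurableSet A) (hΛ : Λ A ≠ ⊤) (y : ℝ) :
    ∫ ω, y ^ (pointCount X A ω).toNat ∂P = Real.exp (-(Λ.real A * (1 - y))) := by
  have hm := measurable_pointCount hX.measurable hA
  have := integral_pow_poissonMeasure (Λ A).toNNReal y
  rw [← hX.map_pointCount_toNat hA hΛ, integral_map
    (hm.enat_toNat).aemeasurable .of_discrete] at this
  exact this

/-- The product is ∏ y^{N_y} with independent Poisson counts N_y of the level sets in `S`. A level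
set of mass λ_y contributes exp(-λ_y(1-y)), and the exponents sum to the integral of 1 - f. The
measurability part feeds the dominated convergence in the general case. -/
theorem integral_pointProd_simpleFunc [IsProbabilityMeasure P] (hX : IsPoissonPointProcess X Λ P)
    {S : Set E} (hS : MeasurableSet S) (hΛ : Λ S ≠ ⊤) (f : SimpleFunc E ℝ) :
    (AEStronglyMeasurable (pointProd X S f) P) ∧
    ∫ ω, pointProd X S f ω ∂P =
      Real.exp (-∫ x in S, (1 - f x) ∂Λ) := by
  have hae : (pointProd X S f) =ᵐ[P]
      fun ω => ∏ y : f.range, (y : ℝ) ^ (pointCount X (S ∩ f ⁻¹' {(y : ℝ)}) ω).toNat := by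
    filter_upwards [hX.ae_finite hS hΛ] with ω hω
    rw [pointProd_eq_prod_pow_pointCount f hω,
      Finset.prod_coe_sort f.range fun y => y ^ (pointCount X (S ∩ f ⁻¹' {(y : ℝ)}) ω).toNat]
  have hAm : ∀ y, MeasurableSet (S ∩ f ⁻¹' {(y : ℝ)}) := fun y =>
    hS.inter (f.measurableSet_preimage _)
  have hAfin : ∀ y : ℝ, Λ (S ∩ f ⁻¹' {y}) ≠ ⊤ := fun y =>
    ((measure_mono Set.inter_subset_left).trans_lt hΛ.lt_top).ne
  have hcm : ∀ y : ℝ, Measurable (pointCount X (S ∩ f ⁻¹' {y})) := fun y =>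
    measurable_pointCount hX.measurable (hAm y)
  have hpm : ∀ y : ℝ, Measurable fun ω => y ^ (pointCount X (S ∩ f ⁻¹' {y}) ω).toNat := fun y =>
    (Measurable.of_discrete (f := fun c : ℕ∞ => y ^ c.toNat)).comp (hcm y)
  refine ⟨⟨_, (Finset.measurable_fun_prod Finset.univ fun (y : f.range) _ => hpm y).stronglyMeasurable, hae⟩, ?_⟩
  rw [integral_congr_ae hae]
  -- Independence of counts is given for families over `Fin k`, so the values of `f` are enumerated.
  let e := f.range.equivFin
  have hind := hX.count_indep _ (fun j => S ∩ f ⁻¹' {((e.symm j : f.range) : ℝ)})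
    (fun j => hAm _) (by
      intro i j hij
      refine Set.disjoint_left.2 fun x hi hj => hij ?_
      have hi' : f x = _ := hi.2
      have hj' : f x = _ := hj.2
      exact e.symm.injective (Subtype.ext (hi'.symm.trans hj')))
  have h1 := hind.integral_fun_prod_comp (𝕜 := ℝ)
    (f := fun j c => ((e.symm j : f.range) : ℝ) ^ c.toNat)
    (fun j => (hcm _).aemeasurable) (fun j => Measurable.of_discrete.aestronglyMeasurable)
  have h2 : ∀ ω, ∏ y : f.range, (y : ℝ) ^ (pointCount X (S ∩ f ⁻¹' {(y : ℝ)}) ω).toNat =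
      ∏ j, ((e.symm j : f.range) : ℝ) ^
        (pointCount X (S ∩ f ⁻¹' {((e.symm j : f.range) : ℝ)}) ω).toNat := fun ω =>
    (e.symm.prod_comp fun y : f.range =>
      (y : ℝ) ^ (pointCount X (S ∩ f ⁻¹' {(y : ℝ)}) ω).toNat).symm
  simp_rw [h2]
  rw [h1]
  simp_rw [hX.integral_pow_pointCount (hAm _) (hAfin _)]
  rw [e.symm.prod_comp fun y : f.range =>
    Real.exp (-(Λ.real (S ∩ f ⁻¹' {(y : ℝ)}) * (1 - y))), ← Real.exp_sum,
    Finset.sum_coe_sort f.range fun y => -(Λ.real (S ∩ f ⁻¹' {(y : ℝ)}) * (1 - y))]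
  congr 1
  have hfin : IsFiniteMeasure (Λ.restrict S) := ⟨by simpa using hΛ.lt_top⟩
  have hint : Integrable f (Λ.restrict S) := SimpleFunc.integrable_of_isFiniteMeasure f
  have hreal : ∀ y : ℝ, (Λ.restrict S).real (f ⁻¹' {y}) = Λ.real (S ∩ f ⁻¹' {y}) := fun y => by
    rw [measureReal_restrict_apply (f.measurableSet_preimage _), Set.inter_comm]
  have hsum : (Λ.restrict S).real Set.univ = ∑ y ∈ f.range, Λ.real (S ∩ f ⁻¹' {y}) := by
    simp_rw [← hreal, measureReal_def]
    rw [← f.sum_range_measure_preimage_singleton, ENNReal.toReal_sum]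
    exact fun _ _ => measure_ne_top _ _
  rw [integral_sub (integrable_const _) hint, integral_const, hsum,
    SimpleFunc.integral_eq_sum f hint]
  simp_rw [hreal, smul_eq_mul, mul_one]
  rw [← Finset.sum_sub_distrib, ← Finset.sum_neg_distrib]
  exact Finset.sum_congr rfl fun y _ => by ring

/-- The probability generating functional of a Poisson point process. -/
theorem integral_pointProd [IsProbabilityMeasure P] (hX : IsPoissonPointProcess X Λ P)
    {S : Set E} (hS : MeasurableSet S) (hΛ : Λ S ≠ ⊤) {u : E → ℝ} (hu : Measurable u)
    (hu1 : ∀ x, u x ∈ Set.Icc 0 1) :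
    ∫ ω, pointProd X S u ω ∂P =
      Real.exp (-∫ x in S, (1 - u x) ∂Λ) := by
  have h0 : (0 : ℝ) ∈ Set.Icc (0 : ℝ) 1 := by simp
  -- The approximants take values in [0,1], so the products stay in [0,1] and the constant 1
  -- dominates on both sides of the identity.
  let F : ℕ → SimpleFunc E ℝ := SimpleFunc.approxOn u hu (Set.Icc 0 1) 0 h0
  have hF : ∀ k x, F k x ∈ Set.Icc (0 : ℝ) 1 := SimpleFunc.approxOn_mem hu h0
  have hFt : ∀ x, Tendsto (fun k => F k x) atTop (𝓝 (u x)) := fun x =>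
    SimpleFunc.tendsto_approxOn hu h0 (subset_closure (hu1 x))
  have hfin : IsFiniteMeasure (Λ.restrict S) := ⟨by simpa using hΛ.lt_top⟩
  have hL : Tendsto (fun k => ∫ ω, pointProd X S (F k) ω ∂P) atTop
      (𝓝 (∫ ω, pointProd X S u ω ∂P)) := by
    refine tendsto_integral_of_dominated_convergence (fun _ => 1)
      (fun k => (hX.integral_pointProd_simpleFunc hS hΛ (F k)).1) (integrable_const _) ?_ ?_
    · intro k
      filter_upwards [hX.ae_finite hS hΛ] with ω hω
      rw [pointProd_eq _ hω, Real.norm_eq_abs,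
        abs_of_nonneg (Finset.prod_nonneg fun n _ => (hF k _).1)]
      exact Finset.prod_le_one (fun n _ => (hF k _).1) fun n _ => (hF k _).2
    · filter_upwards [hX.ae_finite hS hΛ] with ω hω
      simp_rw [pointProd_eq _ hω]
      exact tendsto_finsetProd _ fun n _ => hFt _
  have hR : Tendsto (fun k => ∫ x in S, (1 - F k x) ∂Λ) atTop (𝓝 (∫ x in S, (1 - u x) ∂Λ)) := by
    refine tendsto_integral_of_dominated_convergence (fun _ => 1)
      (fun k => (measurable_const.sub (F k).measurable).aestronglyMeasurable)
      (integrable_const _) ?_ ?_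
    · intro k
      refine ae_of_all _ fun x => ?_
      rw [Real.norm_eq_abs, abs_le]
      have := hF k x
      constructor <;> linarith [this.1, this.2]
    · exact ae_of_all _ fun x => tendsto_const_nhds.sub (hFt x)
  refine tendsto_nhds_unique hL ?_
  simp_rw [(hX.integral_pointProd_simpleFunc hS hΛ (F _)).2]
  exact (Real.continuous_exp.tendsto _).comp hR.neg

end IsPoissonPointProcess

/-! ### Void probabilities of the marked process -/

theorem measureReal_compProd {E M : Type*} [MeasurableSpace E] [MeasurableSpace M]
    {Λ : Measure E} [SFinite Λ] {K : Kernel E M} [IsMarkovKernel K] {B : Set (E × M)}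
    (hB : MeasurableSet B) : (Λ ⊗ₘ K).real B = ∫ x, (K x).real (Prod.mk x ⁻¹' B) ∂Λ := by
  rw [measureReal_def, Measure.compProd_apply hB, ← integral_toReal]
  · rfl
  · exact (Kernel.measurable_kernel_prodMk_left (κ := K) hB).aemeasurable
  · exact ae_of_all _ fun x => measure_lt_top _ _

/-- Avoidance probabilities of an independently marked Poisson point process. -/
theorem IsIndependentMarking.measureReal_forall_notMem {Ω E M : Type*} [MeasurableSpace Ω]
    [MeasurableSpace E] [MeasurableSpace M] {X : ℕ → Ω → E} {Y : ℕ → Ω → M} {Λ : Measure E}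
    [SFinite Λ] {K : Kernel E M} [IsMarkovKernel K] {P : Measure Ω} [IsProbabilityMeasure P]
    (hX : IsPoissonPointProcess X Λ P) (hY : IsIndependentMarking X Y K P)
    {S : Set E} (hS : MeasurableSet S) (hΛ : Λ S ≠ ⊤) {B : Set (E × M)} (hB : MeasurableSet B)
    (hBS : B ⊆ S ×ˢ Set.univ) :
    P.real {ω | ∀ n, (X n ω, Y n ω) ∉ B} = Real.exp (-(Λ ⊗ₘ K).real B) := by
  -- Given the points, a point at x avoids `B` with probability `u x`, which equals 1 outside `S`.
  -- Hence the void probability is the mean of a product over the points in `S` only.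
  set u : E → ℝ := fun x => (K x).real (Prod.mk x ⁻¹' Bᶜ) with hu
  have hum : Measurable u :=
    (Kernel.measurable_kernel_prodMk_left (κ := K) hB.compl).ennreal_toReal
  have hu1 : ∀ x, u x ∈ Set.Icc (0 : ℝ) 1 := fun x => ⟨measureReal_nonneg, measureReal_le_one⟩
  have huS : ∀ x ∉ S, u x = 1 := by
    intro x hx
    have : Prod.mk x ⁻¹' Bᶜ = Set.univ := by
      ext y
      simpa using fun h => hx (hBS h).1
    simp only [hu]
    rw [this, probReal_univ]
  have hcompl : ∀ x, 1 - u x = (K x).real (Prod.mk x ⁻¹' B) := by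
    intro x
    have hm : MeasurableSet (Prod.mk x ⁻¹' B) := measurable_prodMk_left hB
    rw [hu]
    simp only [Set.preimage_compl]
    rw [probReal_compl_eq_one_sub hm]; ring
  have hevm : ∀ N : ℕ, MeasurableSet {ω | ∀ n ∈ Finset.range N, (X n ω, Y n ω) ∈ Bᶜ} := by
    intro N
    have : MeasurableSet (⋂ n ∈ Finset.range N, (fun ω => (X n ω, Y n ω)) ⁻¹' Bᶜ) :=
      Finset.measurableSet_biInter _ fun n _ => ((hX.measurable n).prodMk (hY.measurable n)) hB.compl
    convert this using 1
    ext ω; simp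
  have hfinN : ∀ N : ℕ, P.real {ω | ∀ n ∈ Finset.range N, (X n ω, Y n ω) ∈ Bᶜ} =
      ∫ ω, ∏ n ∈ Finset.range N, u (X n ω) ∂P := by
    intro N
    rw [measureReal_def, hY.measure_forall_mem hX.measurable hB.compl, ← integral_toReal]
    · simp_rw [ENNReal.toReal_prod]; rfl
    · exact (Finset.measurable_fun_prod _ fun n _ => (Kernel.measurable_kernel_prodMk_left
        (κ := K) hB.compl).comp (hX.measurable n)).aemeasurable
    · refine ae_of_all _ fun ω => ?_
      exact ENNReal.prod_lt_top fun n _ => measure_lt_top _ _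
  have hL : Tendsto (fun N : ℕ => P.real {ω | ∀ n ∈ Finset.range N, (X n ω, Y n ω) ∈ Bᶜ}) atTop
      (𝓝 (P.real {ω | ∀ n, (X n ω, Y n ω) ∉ B})) := by
    have h := tendsto_measure_iInter_atTop (μ := P)
      (s := fun N : ℕ => {ω | ∀ n ∈ Finset.range N, (X n ω, Y n ω) ∈ Bᶜ})
      (fun N => (hevm N).nullMeasurableSet)
      (fun N N' h ω hω n hn => hω n (Finset.range_mono h hn)) ⟨0, measure_ne_top _ _⟩
    have he : (⋂ N : ℕ, {ω | ∀ n ∈ Finset.range N, (X n ω, Y n ω) ∈ Bᶜ}) =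
        {ω | ∀ n, (X n ω, Y n ω) ∉ B} := by
      ext ω
      simp only [Set.mem_iInter, Set.mem_ofPred_eq, Finset.mem_range, Set.mem_compl_iff]
      exact ⟨fun h n => h (n + 1) n (Nat.lt_succ_self n), fun h _ n _ => h n⟩
    rw [he] at h
    exact (ENNReal.tendsto_toReal (measure_ne_top _ _)).comp h
  -- Almost surely only finitely many points lie in `S`, so the partial products are eventually
  -- constant.
  have hR : Tendsto (fun N : ℕ => ∫ ω, ∏ n ∈ Finset.range N, u (X n ω) ∂P) atTop
      (𝓝 (∫ ω, pointProd X S u ω ∂P)) := by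
    refine tendsto_integral_of_dominated_convergence (fun _ => 1)
      (fun N => (Finset.measurable_fun_prod _ fun n _ =>
        hum.comp (hX.measurable n)).aestronglyMeasurable) (integrable_const _) ?_ ?_
    · intro N
      refine ae_of_all _ fun ω => ?_
      rw [Real.norm_eq_abs, abs_of_nonneg (Finset.prod_nonneg fun n _ => (hu1 _).1)]
      exact Finset.prod_le_one (fun n _ => (hu1 _).1) fun n _ => (hu1 _).2
    · filter_upwards [hX.ae_finite hS hΛ] with ω hω
      rw [pointProd_eq _ hω]
      obtain ⟨N₀, hN₀⟩ := hω.toFinset.exists_nat_subset_range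
      refine tendsto_atTop_of_eventually_const (i₀ := N₀) fun N hN => ?_
      refine (Finset.prod_subset (hN₀.trans (Finset.range_mono hN)) fun n _ hn => ?_).symm
      exact huS _ (by simpa using hn)
  simp_rw [hfinN] at hL
  rw [tendsto_nhds_unique hL hR, hX.integral_pointProd hS hΛ hum hu1]
  congr 2
  simp_rw [hcompl]
  rw [setIntegral_eq_integral_of_forall_compl_eq_zero (fun x hx => by rw [← hcompl, huS x hx, sub_self]),
    measureReal_compProd hB]

/-! ### A refinement principle for interval functions -/

/-- A subadditive interval function whose increments are of second order is nonpositive. -/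
theorem nonpos_of_subadditive_of_le_mul {q : ℝ → ℝ → ℝ} {H : ℝ → ℝ} {a b C : ℝ} (hab : a ≤ b)
    (hadd : ∀ s t u, a ≤ s → s ≤ t → t ≤ u → u ≤ b → q s u ≤ q s t + q t u)
    (hle : ∀ s t, a ≤ s → s ≤ t → t ≤ b → q s t ≤ (H t - H s) * (C * (t - s))) :
    q a b ≤ 0 := by
  -- Cut [a,b] into n+1 pieces of equal length d. The increments of `H` telescope while the factor
  -- `C * d` is common to all pieces, so the total error is of order 1/(n+1) without any continuity
  -- of `H`.
  have hn : ∀ n : ℕ, q a b ≤ (H b - H a) * (C * (b - a)) * (1 / ((n : ℝ) + 1)) := by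
    intro n
    set d : ℝ := (b - a) / ((n : ℝ) + 1) with hd
    have hd0 : 0 ≤ d := div_nonneg (sub_nonneg.2 hab) (by positivity)
    have hdn : ((n + 1 : ℕ) : ℝ) * d = b - a := by
      rw [hd]; push_cast; field_simp
    have key : ∀ k : ℕ, k ≤ n + 1 →
        q a (a + k * d) ≤ (H (a + k * d) - H a) * (C * d) := by
      intro k
      induction k with
      | zero =>
        intro _
        have := hle a a le_rfl le_rfl hab
        simpa using this
      | succ k ih =>
        intro hk
        have h1 : a ≤ a + k * d := le_add_of_nonneg_right (by positivity)
        have h2 : a + k * d ≤ a + (k + 1 : ℕ) * d := by push_cast; nlinarith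
        have h3 : a + (k + 1 : ℕ) * d ≤ b := by
          have : ((k + 1 : ℕ) : ℝ) * d ≤ ((n + 1 : ℕ) : ℝ) * d :=
            mul_le_mul_of_nonneg_right (by exact_mod_cast hk) hd0
          linarith
        have h4 := hadd a _ _ le_rfl h1 h2 h3
        have h5 := hle _ _ h1 h2 h3
        have h6 := ih (by omega)
        have h7 : a + ((k + 1 : ℕ) : ℝ) * d - (a + k * d) = d := by push_cast; ring
        rw [h7] at h5
        linarith
    have := key (n + 1) le_rfl
    rw [hdn, add_sub_cancel] at this
    refine this.trans_eq ?_
    rw [hd]; ring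
  have ht : Tendsto (fun n : ℕ => (H b - H a) * (C * (b - a)) * (1 / ((n : ℝ) + 1))) atTop
      (𝓝 0) := by
    simpa using tendsto_one_div_add_atTop_nhds_zero_nat.const_mul ((H b - H a) * (C * (b - a)))
  exact ge_of_tendsto' ht hn

/-! ### Tail of the Nakagami distribution -/

section Nakagami

variable {m s : ℝ}

/-- The substitution t = (m/s) x² turns the density into that of the Gamma distribution with shape
m. The condition on `B ∩ Set.Ioi 0` covers both the tails and, with z = 0, the total mass. -/
theorem nakagamiMeasure_apply_of_inter_eq {B : Set ℝ} (hB : MeasurableSet B) (hm : 0 < m)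
    (hs : 0 < s) {z : ℝ} (hz : 0 ≤ z) (hBz : B ∩ Set.Ioi 0 = Set.Ioi z) :
    nakagamiMeasure m s B = ENNReal.ofReal
      (1 - (∫ t in (0 : ℝ)..m / s * z ^ 2, t ^ (m - 1) * Real.exp (-t)) / Real.Gamma m) := by
  have hms : 0 < m / s := div_pos hm hs
  have hΓ : 0 < Real.Gamma m := Real.Gamma_pos_of_pos hm
  have himg : (fun x => m / s * x ^ 2) '' Set.Ioi z = Set.Ioi (m / s * z ^ 2) := by
    ext t
    constructor
    · rintro ⟨x, hx, rfl⟩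
      have hx : z < x := hx
      exact mul_lt_mul_of_pos_left (pow_lt_pow_left₀ hx hz two_ne_zero) hms
    · intro ht
      have ht : m / s * z ^ 2 < t := ht
      have h1 : z ^ 2 < t / (m / s) := by rwa [lt_div_iff₀' hms]
      refine ⟨√(t / (m / s)), Real.lt_sqrt_of_sq_lt h1, ?_⟩
      simp only
      rw [Real.sq_sqrt ((sq_nonneg z).trans h1.le)]
      field_simp
  have hconv : IntegrableOn (fun t => t ^ (m - 1) * Real.exp (-t)) (Set.Ioi 0) :=
    (Real.GammaIntegral_convergent hm).congr_fun (fun t _ => mul_comm _ _) measurableSet_Ioi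
  have hz2 : 0 ≤ m / s * z ^ 2 := by positivity
  have hint : IntegrableOn (fun t => t ^ (m - 1) * Real.exp (-t)) (Set.Ioi (m / s * z ^ 2)) :=
    hconv.mono_set (Set.Ioi_subset_Ioi hz2)
  have hGamma : ∫ t in Set.Ioi (m / s * z ^ 2), t ^ (m - 1) * Real.exp (-t) =
      Real.Gamma m - ∫ t in (0 : ℝ)..m / s * z ^ 2, t ^ (m - 1) * Real.exp (-t) := by
    rw [Real.Gamma_eq_integral hm]
    have : ∫ t in Set.Ioi (0 : ℝ), Real.exp (-t) * t ^ (m - 1) =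
        ∫ t in Set.Ioi (0 : ℝ), t ^ (m - 1) * Real.exp (-t) := by simp_rw [mul_comm]
    rw [this, ← intervalIntegral.integral_interval_add_Ioi hconv hint]
    ring
  have hcov := lintegral_image_eq_lintegral_deriv_mul_of_monotoneOn (measurableSet_Ioi (a := z))
    (f := fun x => m / s * x ^ 2) (f' := fun x => m / s * (2 * x))
    (fun x _ => by
      simpa using ((hasDerivAt_pow 2 x).const_mul (m / s)).hasDerivWithinAt)
    (fun x hx y _ hxy => mul_le_mul_of_nonneg_left
      (pow_le_pow_left₀ (hz.trans (le_of_lt hx)) hxy 2) hms.le)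
    (fun t => ENNReal.ofReal (t ^ (m - 1) * Real.exp (-t) / Real.Gamma m))
  rw [himg] at hcov
  rw [nakagamiMeasure, withDensity_apply _ hB, Measure.restrict_restrict hB, hBz]
  calc _ = ∫⁻ x in Set.Ioi z, ENNReal.ofReal (m / s * (2 * x)) *
        ENNReal.ofReal ((m / s * x ^ 2) ^ (m - 1) * Real.exp (-(m / s * x ^ 2)) / Real.Gamma m) := by
        refine setLIntegral_congr_fun measurableSet_Ioi fun x hx => ?_
        have hx0 : 0 < x := hz.trans_lt hx
        rw [← ENNReal.ofReal_mul (by positivity)]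
        congr 1
        have e1 : (m / s * x ^ 2) ^ (m - 1) * (m / s * x ^ 2) = (m / s) ^ m * x ^ (2 * m) := by
          rw [← Real.rpow_add_one (by positivity), sub_add_cancel,
            Real.mul_rpow hms.le (by positivity), ← Real.rpow_natCast, ← Real.rpow_mul hx0.le]
          norm_num
        have e2 : x ^ (2 * m - 1) * x = x ^ (2 * m) := by
          rw [← Real.rpow_add_one hx0.ne', sub_add_cancel]
        have e3 : (m / s) ^ m = m ^ m / s ^ m := Real.div_rpow hm.le hs.le m
        have hsm : s ^ m ≠ 0 := (Real.rpow_pos_of_pos hs m).ne'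
        rw [show -(m / s) * x ^ 2 = -(m / s * x ^ 2) by ring]
        -- Multiplying by x raises the exponents m - 1 and 2m - 1 to m and 2m, where the real powers
        -- can be compared.
        have e4 : x * (m / s * (2 * x) * (m / s * x ^ 2) ^ (m - 1)) =
            x * (2 * m ^ m / s ^ m * x ^ (2 * m - 1)) := by
          calc _ = 2 * ((m / s * x ^ 2) ^ (m - 1) * (m / s * x ^ 2)) := by ring
            _ = 2 * m ^ m / s ^ m * (x ^ (2 * m - 1) * x) := by rw [e1, e2, e3]; ring
            _ = _ := by ring
        have e5 := mul_left_cancel₀ hx0.ne' e4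
        calc _ = (2 * m ^ m / s ^ m * x ^ (2 * m - 1)) * Real.exp (-(m / s * x ^ 2)) /
              Real.Gamma m := by field_simp
          _ = _ := by rw [← e5]; ring
    _ = ∫⁻ t in Set.Ioi (m / s * z ^ 2),
        ENNReal.ofReal (t ^ (m - 1) * Real.exp (-t) / Real.Gamma m) := hcov.symm
    _ = ENNReal.ofReal (∫ t in Set.Ioi (m / s * z ^ 2),
        t ^ (m - 1) * Real.exp (-t) / Real.Gamma m) := by
        rw [ofReal_integral_eq_lintegral_ofReal (hint.div_const _)]
        refine (ae_restrict_mem measurableSet_Ioi).mono fun t ht => ?_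
        have : 0 < t := hz2.trans_lt ht
        simp only [Pi.zero_apply]
        positivity
    _ = _ := by
        rw [integral_div, hGamma, sub_div, div_self hΓ.ne']

theorem nakagamiMeasure_Ioi (hm : 0 < m) (hs : 0 < s) {z : ℝ} (hz : 0 ≤ z) :
    nakagamiMeasure m s (Set.Ioi z) = ENNReal.ofReal
      (1 - (∫ t in (0 : ℝ)..m / s * z ^ 2, t ^ (m - 1) * Real.exp (-t)) / Real.Gamma m) :=
  nakagamiMeasure_apply_of_inter_eq measurableSet_Ioi hm hs hz
    (by rw [Set.Ioi_inter_Ioi, sup_eq_left.2 hz])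

theorem isProbabilityMeasure_nakagamiMeasure (hm : 0 < m) (hs : 0 < s) :
    IsProbabilityMeasure (nakagamiMeasure m s) :=
  ⟨by rw [nakagamiMeasure_apply_of_inter_eq .univ hm hs le_rfl (Set.univ_inter _)]; simp⟩

end Nakagami

/-! ### Polar coordinates and the passage from horizontal to link distance -/

theorem integral_fun_norm_euclideanSpace_fin_two (F : ℝ → ℝ) :
    ∫ x : EuclideanSpace ℝ (Fin 2), F ‖x‖ = 2 * Real.pi * ∫ ρ in Set.Ioi (0 : ℝ), ρ * F ρ := by
  rw [integral_fun_norm_addHaar, measureReal_def, EuclideanSpace.volume_ball]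
  have : Real.Gamma (1 + 1) = 1 := by
    rw [Real.Gamma_add_one one_ne_zero, Real.Gamma_one, one_mul]
  simp [this, Real.pi_pos.le, mul_assoc]

/-- With r² = ρ² + h² one has ρ dρ = r dr. The substitution ρ = √(r² - h²) is made on the half-open
interval (s,t], which leaves out r = h, where it need not be differentiable; `F` can be arbitrary.
-/
theorem integral_comp_sqrt_add_sq {h s t : ℝ} (hh : 0 ≤ h) (hs : h ≤ s) (hst : s ≤ t)
    (F : ℝ → ℝ) :
    ∫ ρ in √(s ^ 2 - h ^ 2)..√(t ^ 2 - h ^ 2), ρ * F (√(ρ ^ 2 + h ^ 2)) =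
      ∫ r in s..t, r * F r := by
  have hmono : ∀ {u v : ℝ}, h ≤ u → u ≤ v → √(u ^ 2 - h ^ 2) ≤ √(v ^ 2 - h ^ 2) := fun hu huv =>
    Real.sqrt_le_sqrt (sub_le_sub_right (pow_le_pow_left₀ (hh.trans hu) huv 2) _)
  have hsm : ∀ {u v : ℝ}, h ≤ u → u < v → √(u ^ 2 - h ^ 2) < √(v ^ 2 - h ^ 2) := fun {u v} hu huv =>
    Real.sqrt_lt_sqrt (sub_nonneg.2 (pow_le_pow_left₀ hh hu 2))
      (sub_lt_sub_right (pow_lt_pow_left₀ huv (hh.trans hu) two_ne_zero) _)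
  have hinv : ∀ {u : ℝ}, h ≤ u → √(√(u ^ 2 - h ^ 2) ^ 2 + h ^ 2) = u := fun {u} hu => by
    rw [Real.sq_sqrt (sub_nonneg.2 (pow_le_pow_left₀ hh hu 2)), sub_add_cancel,
      Real.sqrt_sq (hh.trans hu)]
  have himg : (fun r => √(r ^ 2 - h ^ 2)) '' Set.Ioc s t =
      Set.Ioc (√(s ^ 2 - h ^ 2)) (√(t ^ 2 - h ^ 2)) := by
    ext ρ
    constructor
    · rintro ⟨r, hr, rfl⟩
      exact ⟨hsm hs hr.1, hmono (hs.trans hr.1.le) hr.2⟩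
    · rintro ⟨h1, h2⟩
      have hρ : 0 ≤ ρ := (Real.sqrt_nonneg _).trans h1.le
      have h3 : √(√(s ^ 2 - h ^ 2) ^ 2 + h ^ 2) < √(ρ ^ 2 + h ^ 2) :=
        Real.sqrt_lt_sqrt (by positivity)
          (add_lt_add_left (pow_lt_pow_left₀ h1 (Real.sqrt_nonneg _) two_ne_zero) _)
      have h4 : √(ρ ^ 2 + h ^ 2) ≤ √(√(t ^ 2 - h ^ 2) ^ 2 + h ^ 2) :=
        Real.sqrt_le_sqrt (add_le_add_left (pow_le_pow_left₀ hρ h2 2) _)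
      rw [hinv hs] at h3
      rw [hinv (hs.trans hst)] at h4
      refine ⟨√(ρ ^ 2 + h ^ 2), ⟨h3, h4⟩, ?_⟩
      simp only
      rw [Real.sq_sqrt (by positivity), add_sub_cancel_right, Real.sqrt_sq hρ]
  rw [intervalIntegral.integral_of_le (hmono hs hst), intervalIntegral.integral_of_le hst,
    ← himg, integral_image_eq_integral_abs_deriv_smul (f' := fun r => r / √(r ^ 2 - h ^ 2))
      measurableSet_Ioc]
  · refine setIntegral_congr_fun measurableSet_Ioc fun r hr => ?_
    have hr0 : 0 < √(r ^ 2 - h ^ 2) := (Real.sqrt_nonneg _).trans_lt (hsm hs hr.1)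
    have hr1 : 0 ≤ r := (hh.trans hs).trans hr.1.le
    simp only [smul_eq_mul]
    rw [hinv (hs.trans hr.1.le), abs_of_nonneg (by positivity), ← mul_assoc,
      div_mul_cancel₀ _ hr0.ne']
  · intro r hr
    have hr0 : 0 < √(r ^ 2 - h ^ 2) := (Real.sqrt_nonneg _).trans_lt (hsm hs hr.1)
    have hd := (((hasDerivAt_pow 2 r).sub_const (h ^ 2)).sqrt
      (Real.sqrt_pos.1 hr0).ne').hasDerivWithinAt (s := Set.Ioc s t)
    have he : r / √(r ^ 2 - h ^ 2) = ((2 : ℕ) : ℝ) * r ^ (2 - 1) / (2 * √(r ^ 2 - h ^ 2)) := by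
      push_cast
      rw [pow_one, mul_div_mul_left _ _ two_ne_zero]
    rw [he]
    exact hd
  · intro u hu v hv huv
    by_contra hne
    rcases lt_or_gt_of_ne hne with hlt | hlt
    · exact (hsm (hs.trans hu.1.le) hlt).ne huv
    · exact (hsm (hs.trans hv.1.le) hlt).ne' huv

/-! ### Intensity of the marked UAV process -/

namespace LinkState

theorem sum_eq_add_opp {α : Type*} [AddCommMonoid α] (g : LinkState → α) (i : LinkState) :
    ∑ j, g j = g i + g i.opp := by
  have h : (Finset.univ : Finset LinkState) = {.los, .nlos} := rfl
  cases i <;> simp [h, opp, add_comm]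

theorem opp_ne (i : LinkState) : i.opp ≠ i := by cases i <;> simp [opp]

theorem eq_or_eq_opp (i j : LinkState) : j = i ∨ j = i.opp := by
  cases i <;> cases j <;> simp [opp]

end LinkState

namespace NetworkParams

variable (p : NetworkParams)

theorem one_le_one_add_envC_mul_exp (x : ℝ) : 1 ≤ 1 + p.envC * Real.exp x :=
  le_add_of_nonneg_right (mul_nonneg p.envC_nonneg (Real.exp_pos _).le)

theorem stateProb_nonneg (i : LinkState) (r : ℝ) : 0 ≤ p.stateProb i r := by
  have h := p.one_le_one_add_envC_mul_exp
    (-p.envY * (Real.arcsin (p.h / r) * (180 / Real.pi) - p.envC))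
  cases i
  · exact div_nonneg zero_le_one (zero_le_one.trans h)
  · exact sub_nonneg.2 (div_le_one_of_le₀ h (zero_le_one.trans h))

theorem stateProb_add_stateProb_opp (i : LinkState) (r : ℝ) :
    p.stateProb i r + p.stateProb i.opp r = 1 := by
  cases i <;> simp [stateProb, LinkState.opp]

theorem stateProb_le_one (i : LinkState) (r : ℝ) : p.stateProb i r ≤ 1 := by
  linarith [p.stateProb_add_stateProb_opp i r, p.stateProb_nonneg i.opp r]

theorem measurable_stateProb (i : LinkState) : Measurable (p.stateProb i) := by
  have h : Measurable fun r => Real.arcsin (p.h / r) :=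
    Real.continuous_arcsin.measurable.comp (measurable_const.div measurable_id)
  have hl : Measurable (p.stateProb .los) := by
    change Measurable fun r => 1 / (1 + p.envC *
      Real.exp (-p.envY * (Real.arcsin (p.h / r) * (180 / Real.pi) - p.envC)))
    fun_prop
  cases i
  · exact hl
  · exact measurable_const.sub hl

theorem measurable_dist : Measurable p.dist := by
  unfold dist; fun_prop

theorem norm_le_dist (x : EuclideanSpace ℝ (Fin 2)) : ‖x‖ ≤ p.dist x :=
  Real.le_sqrt_of_sq_le (by nlinarith [sq_nonneg p.h])

theorem h_lt_dist {x : EuclideanSpace ℝ (Fin 2)} (hx : x ≠ 0) : p.h < p.dist x :=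
  Real.lt_sqrt_of_sq_lt (lt_add_of_pos_left _ (pow_pos (norm_pos_iff.2 hx) 2))

instance (i : LinkState) : IsProbabilityMeasure (nakagamiMeasure (p.m i) (p.spread i)) :=
  isProbabilityMeasure_nakagamiMeasure (p.m_pos i) (p.spread_pos i)

/-- The law of the marks as a kernel. -/
noncomputable def markKernel : Kernel (EuclideanSpace ℝ (Fin 2)) (LinkState × ℝ) where
  toFun := p.markLaw
  measurable' := by
    refine Measure.measurable_of_measurable_coe _ fun s _ => ?_
    simp only [markLaw, Measure.coe_finsetSum, Finset.sum_apply, Measure.smul_apply, smul_eq_mul]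
    exact Finset.measurable_fun_sum _ fun i _ =>
      ((p.measurable_stateProb i).comp p.measurable_dist).ennreal_ofReal.mul_const _

theorem coe_markKernel : ⇑p.markKernel = p.markLaw := rfl

instance : IsMarkovKernel p.markKernel where
  isProbabilityMeasure x := ⟨by
    rw [coe_markKernel, markLaw, LinkState.sum_eq_add_opp _ .los]
    simp only [Measure.add_apply, Measure.smul_apply, measure_univ, smul_eq_mul, mul_one]
    rw [← ENNReal.ofReal_add (p.stateProb_nonneg _ _) (p.stateProb_nonneg _ _),
      stateProb_add_stateProb_opp, ENNReal.ofReal_one]⟩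

theorem markKernel_real_prod (x : EuclideanSpace ℝ (Fin 2)) (i : LinkState) (B : Set ℝ) :
    (p.markKernel x).real ({i} ×ˢ B) =
      p.stateProb i (p.dist x) * (nakagamiMeasure (p.m i) (p.spread i)).real B := by
  rw [measureReal_def, coe_markKernel, markLaw, LinkState.sum_eq_add_opp _ i]
  simp [Measure.prod_prod, p.stateProb_nonneg, i.opp_ne, measureReal_def, ENNReal.toReal_mul]

/-- Intensity of the ground projections. -/
noncomputable def groundIntensity : Measure (EuclideanSpace ℝ (Fin 2)) :=
  ENNReal.ofReal p.lam • volume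

instance : SFinite p.groundIntensity := by unfold groundIntensity; infer_instance

/-- Intensity of the process of ground projections marked by state and fading. -/
noncomputable def markedIntensity : Measure (EuclideanSpace ℝ (Fin 2) × (LinkState × ℝ)) :=
  p.groundIntensity ⊗ₘ p.markKernel

theorem measurableSet_dist_le (R : ℝ) : MeasurableSet {x | p.dist x ≤ R} :=
  measurableSet_le p.measurable_dist measurable_const

theorem groundIntensity_dist_le_ne_top (R : ℝ) : p.groundIntensity {x | p.dist x ≤ R} ≠ ⊤ := by
  have h : {x | p.dist x ≤ R} ⊆ Metric.closedBall 0 R := fun x hx => by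
    rw [mem_closedBall_zero_iff]
    exact (p.norm_le_dist x).trans hx
  rw [groundIntensity, Measure.smul_apply, smul_eq_mul]
  exact ENNReal.mul_ne_top ENNReal.ofReal_ne_top
    ((measure_mono h).trans_lt (measure_closedBall_lt_top)).ne

theorem integral_comp_dist (F : ℝ → ℝ) :
    ∫ x, F (p.dist x) ∂p.groundIntensity =
      2 * Real.pi * p.lam * ∫ ρ in Set.Ioi (0 : ℝ), ρ * F (√(ρ ^ 2 + p.h ^ 2)) := by
  rw [groundIntensity, integral_smul_measure, ENNReal.toReal_ofReal p.lam_pos.le, smul_eq_mul]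
  have := integral_fun_norm_euclideanSpace_fin_two fun ρ => F (√(ρ ^ 2 + p.h ^ 2))
  simp only [dist]
  rw [this]; ring

theorem b_nonneg (r : ℝ) : 0 ≤ p.b r := Real.sqrt_nonneg _

theorem b_mono {s t : ℝ} (hs : 0 ≤ s) (hst : s ≤ t) : p.b s ≤ p.b t :=
  Real.sqrt_le_sqrt (sub_le_sub_right (pow_le_pow_left₀ hs hst 2) _)

/-- This includes t < h: there `p.b t` is 0, the default root of a negative number, and both sides
fail because ρ > 0. Distances `p.A i t` below the altitude therefore need no separate case. -/
theorem sqrt_le_iff_le_b {t ρ : ℝ} (ht : 0 ≤ t) (hρ : 0 < ρ) :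
    √(ρ ^ 2 + p.h ^ 2) ≤ t ↔ ρ ≤ p.b t := by
  rw [Real.sqrt_le_iff, b, Real.le_sqrt' hρ, le_sub_iff_add_le]
  exact and_iff_right ht

theorem integral_indicator_Iic_comp_dist (F : ℝ → ℝ) {t : ℝ} (ht : 0 ≤ t) :
    ∫ x, (Set.Iic t).indicator F (p.dist x) ∂p.groundIntensity =
      2 * Real.pi * p.lam * ∫ ρ in (0 : ℝ)..p.b t, F (√(ρ ^ 2 + p.h ^ 2)) * ρ := by
  rw [integral_comp_dist, intervalIntegral.integral_of_le (p.b_nonneg t)]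
  congr 1
  rw [← integral_indicator measurableSet_Ioi, ← integral_indicator measurableSet_Ioc]
  congr 1 with ρ
  by_cases hρ : 0 < ρ
  · by_cases hρ' : ρ ≤ p.b t
    · have := (p.sqrt_le_iff_le_b ht hρ).2 hρ'
      simp [Set.indicator, hρ, hρ', this, mul_comm]
    · have : ¬ √(ρ ^ 2 + p.h ^ 2) ≤ t := fun h => hρ' ((p.sqrt_le_iff_le_b ht hρ).1 h)
      simp [Set.indicator, hρ, hρ', this]
  · simp [Set.indicator, hρ]

theorem integral_indicator_Ioc_comp_dist (F : ℝ → ℝ) {s t : ℝ} (hs : p.h ≤ s) (hst : s ≤ t) :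
    ∫ x, (Set.Ioc s t).indicator F (p.dist x) ∂p.groundIntensity =
      2 * Real.pi * p.lam * ∫ r in s..t, r * F r := by
  have hs0 := p.h_nonneg.trans hs
  rw [integral_comp_dist, ← integral_comp_sqrt_add_sq p.h_nonneg hs hst]
  change _ = _ * ∫ ρ in p.b s..p.b t, _
  rw [intervalIntegral.integral_of_le (p.b_mono hs0 hst)]
  congr 1
  rw [← integral_indicator measurableSet_Ioi, ← integral_indicator measurableSet_Ioc]
  congr 1 with ρ
  by_cases hρ : 0 < ρ
  · have h1 := p.sqrt_le_iff_le_b hs0 hρ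
    have h2 := p.sqrt_le_iff_le_b (hs0.trans hst) hρ
    simp only [Set.indicator, Set.mem_Ioi, hρ, if_true, Set.mem_Ioc, ← not_le, h1, h2, mul_ite,
      mul_zero]
  · have : ¬ p.b s < ρ := fun h => hρ ((p.b_nonneg s).trans_lt h)
    simp [Set.indicator, hρ, this]

/-! ### Regions of marked points -/

/-- Marked points in state `i` whose distance and fading satisfy the condition `D`. -/
def region (i : LinkState) (D : Set (ℝ × ℝ)) :
    Set (EuclideanSpace ℝ (Fin 2) × (LinkState × ℝ)) :=
  {q | q.2.1 = i ∧ (p.dist q.1, q.2.2) ∈ D}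

variable {p}

theorem measurableSet_region {i : LinkState} {D : Set (ℝ × ℝ)} (hD : MeasurableSet D) :
    MeasurableSet (p.region i D) := by
  have h1 : MeasurableSet {q : EuclideanSpace ℝ (Fin 2) × (LinkState × ℝ) | q.2.1 = i} :=
    (measurable_fst.comp measurable_snd) (measurableSet_singleton i)
  have h2 : Measurable fun q : EuclideanSpace ℝ (Fin 2) × (LinkState × ℝ) =>
      (p.dist q.1, q.2.2) :=
    (p.measurable_dist.comp measurable_fst).prodMk (measurable_snd.comp measurable_snd)
  exact h1.inter (h2 hD)

theorem measurableSet_fst_le (t : ℝ) : MeasurableSet {q : ℝ × ℝ | q.1 ≤ t} :=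
  measurableSet_le measurable_fst measurable_const

theorem measurableSet_annulus (s t : ℝ) : MeasurableSet {q : ℝ × ℝ | s < q.1 ∧ q.1 ≤ t} :=
  (measurableSet_lt measurable_const measurable_fst).inter (measurableSet_fst_le t)

theorem measurableSet_annulus_fading (s t : ℝ) {z : ℝ → ℝ} (hz : Measurable z) :
    MeasurableSet {q : ℝ × ℝ | (s < q.1 ∧ q.1 ≤ t) ∧ z q.1 < q.2} :=
  (measurableSet_annulus s t).inter (measurableSet_lt (hz.comp measurable_fst) measurable_snd)

theorem disjoint_region {i : LinkState} {D D' : Set (ℝ × ℝ)} (h : Disjoint D D') :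
    Disjoint (p.region i D) (p.region i D') :=
  Set.disjoint_left.2 fun _ h1 h2 => Set.disjoint_left.1 h h1.2 h2.2

theorem disjoint_region_opp (i : LinkState) (D D' : Set (ℝ × ℝ)) :
    Disjoint (p.region i D) (p.region i.opp D') :=
  Set.disjoint_left.2 fun _ h1 h2 => i.opp_ne (h2.1.symm.trans h1.1)

theorem markedIntensity_real_region {i : LinkState} {D : Set (ℝ × ℝ)} (hD : MeasurableSet D) :
    p.markedIntensity.real (p.region i D) =
      ∫ x, p.stateProb i (p.dist x) *
        (nakagamiMeasure (p.m i) (p.spread i)).real (Prod.mk (p.dist x) ⁻¹' D)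
        ∂p.groundIntensity := by
  rw [markedIntensity, measureReal_compProd (measurableSet_region hD)]
  refine integral_congr_ae (ae_of_all _ fun x => ?_)
  have : Prod.mk x ⁻¹' p.region i D = {i} ×ˢ (Prod.mk (p.dist x) ⁻¹' D) := by
    ext q; simp [region]
  simp only [this, markKernel_real_prod]

variable (p) in
/-- Mean number of UAVs in state `i` at distance at most `t`. -/
noncomputable def meanCount (i : LinkState) (t : ℝ) : ℝ :=
  2 * Real.pi * p.lam * ∫ ρ in (0 : ℝ)..p.b t, p.stateProbHor i ρ * ρ

theorem markedIntensity_real_region_le (i : LinkState) {t : ℝ} (ht : 0 ≤ t) :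
    p.markedIntensity.real (p.region i {q | q.1 ≤ t}) = p.meanCount i t := by
  rw [markedIntensity_real_region (measurableSet_fst_le t), meanCount]
  refine Eq.trans ?_ (p.integral_indicator_Iic_comp_dist (p.stateProb i) ht)
  refine integral_congr_ae (ae_of_all _ fun x => ?_)
  by_cases hx : p.dist x ≤ t
  · have : Prod.mk (p.dist x) ⁻¹' {q : ℝ × ℝ | q.1 ≤ t} = Set.univ := by ext; simp [hx]
    simp [this, Set.indicator, hx]
  · have : Prod.mk (p.dist x) ⁻¹' {q : ℝ × ℝ | q.1 ≤ t} = ∅ := by ext; simp [hx]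
    simp [this, Set.indicator, hx]

theorem markedIntensity_real_region_Ioc (i : LinkState) {s t : ℝ} (hs : p.h ≤ s) (hst : s ≤ t)
    {z : ℝ → ℝ} (hz : Measurable z) :
    p.markedIntensity.real (p.region i {q | (s < q.1 ∧ q.1 ≤ t) ∧ z q.1 < q.2}) =
      ∫ r in s..t, 2 * Real.pi * p.lam * r * p.stateProb i r *
        (nakagamiMeasure (p.m i) (p.spread i)).real (Set.Ioi (z r)) := by
  rw [markedIntensity_real_region (measurableSet_annulus_fading s t hz)]
  have h := p.integral_indicator_Ioc_comp_dist (fun r => p.stateProb i r *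
    (nakagamiMeasure (p.m i) (p.spread i)).real (Set.Ioi (z r))) hs hst
  rw [← intervalIntegral.integral_const_mul] at h
  refine Eq.trans ?_ (h.trans ?_)
  · refine integral_congr_ae (ae_of_all _ fun x => ?_)
    by_cases hx : s < p.dist x ∧ p.dist x ≤ t
    · have : Prod.mk (p.dist x) ⁻¹' {q : ℝ × ℝ | (s < q.1 ∧ q.1 ≤ t) ∧ z q.1 < q.2} =
          Set.Ioi (z (p.dist x)) := by ext; simp [hx]
      simp only [this, Set.indicator_of_mem (Set.mem_Ioc.2 hx)]
    · have : Prod.mk (p.dist x) ⁻¹' {q : ℝ × ℝ | (s < q.1 ∧ q.1 ≤ t) ∧ z q.1 < q.2} = ∅ := by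
        ext; simp only [Set.mem_preimage, Set.mem_ofPred_eq, hx, false_and, Set.mem_empty_iff_false]
      simp only [this, measureReal_empty, mul_zero,
        Set.indicator_of_notMem (fun h => hx (Set.mem_Ioc.1 h))]
  · refine intervalIntegral.integral_congr fun r _ => ?_
    ring

theorem markedIntensity_prod_univ {S : Set (EuclideanSpace ℝ (Fin 2))} (hS : MeasurableSet S) :
    p.markedIntensity (S ×ˢ Set.univ) = p.groundIntensity S := by
  rw [markedIntensity, Measure.compProd_apply_prod hS .univ]
  simp

theorem markedIntensity_region_ne_top {i : LinkState} {D : Set (ℝ × ℝ)} {R : ℝ}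
    (hD : ∀ q ∈ D, q.1 ≤ R) : p.markedIntensity (p.region i D) ≠ ⊤ := by
  have h : p.region i D ⊆ {x | p.dist x ≤ R} ×ˢ Set.univ := fun q hq => ⟨hD _ hq.2, trivial⟩
  refine ((measure_mono h).trans_lt ?_).ne
  rw [markedIntensity_prod_univ (p.measurableSet_dist_le R)]
  exact (p.groundIntensity_dist_le_ne_top R).lt_top

/-! ### Comparison of path gains -/

theorem pathGain_le_iff {i : LinkState} {s d : ℝ} (hs : 0 < s) (hd : 0 < d) :
    p.pathGain i s ≤ p.pathGain i d ↔ d ≤ s := by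
  rw [pathGain, pathGain, mul_le_mul_iff_right₀ (p.C_pos i),
    Real.rpow_le_rpow_iff_of_neg hs hd (neg_lt_zero.2 (p.a_pos i))]

theorem A_pos (i : LinkState) {d : ℝ} (hd : 0 < d) : 0 < p.A i d :=
  Real.rpow_pos_of_pos (mul_pos (div_pos (p.C_pos _) (p.C_pos _)) (Real.rpow_pos_of_pos hd _)) _

theorem A_nonneg (i : LinkState) {d : ℝ} (hd : 0 ≤ d) : 0 ≤ p.A i d :=
  Real.rpow_nonneg (mul_nonneg (div_pos (p.C_pos _) (p.C_pos _)).le (Real.rpow_nonneg hd _)) _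

theorem A_mono (i : LinkState) {s d : ℝ} (hs : 0 ≤ s) (hsd : s ≤ d) : p.A i s ≤ p.A i d :=
  Real.rpow_le_rpow (mul_nonneg (div_pos (p.C_pos _) (p.C_pos _)).le (Real.rpow_nonneg hs _))
    (mul_le_mul_of_nonneg_left (Real.rpow_le_rpow hs hsd (p.a_pos i).le)
      (div_pos (p.C_pos _) (p.C_pos _)).le) (one_div_pos.2 (p.a_pos _)).le

theorem A_lt (i : LinkState) {s d : ℝ} (hs : 0 ≤ s) (hsd : s < d) : p.A i s < p.A i d :=
  Real.rpow_lt_rpow (mul_nonneg (div_pos (p.C_pos _) (p.C_pos _)).le (Real.rpow_nonneg hs _))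
    (mul_lt_mul_of_pos_left (Real.rpow_lt_rpow hs hsd (p.a_pos i))
      (div_pos (p.C_pos _) (p.C_pos _))) (one_div_pos.2 (p.a_pos _))

theorem pathGain_opp_A (i : LinkState) {d : ℝ} (hd : 0 < d) :
    p.pathGain i.opp (p.A i d) = p.pathGain i d := by
  have hC := p.C_pos i
  have hC' := p.C_pos i.opp
  have hd' := Real.rpow_pos_of_pos hd (p.a i)
  have ha := (p.a_pos i.opp).ne'
  rw [pathGain, pathGain, A, ← Real.rpow_mul (by positivity), mul_neg, one_div,
    inv_mul_cancel₀ ha, Real.rpow_neg_one, Real.rpow_neg hd.le]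
  field_simp

theorem pathGain_opp_le_iff {i : LinkState} {s d : ℝ} (hs : 0 < s) (hd : 0 < d) :
    p.pathGain i.opp s ≤ p.pathGain i d ↔ p.A i d ≤ s := by
  rw [← pathGain_opp_A i hd, pathGain_le_iff hs (A_pos i hd)]

/-- `p.ζ Γ i d` is the fading at which the SNR equals Γ. -/
theorem lt_snr_iff {Γ g d : ℝ} {i : LinkState} (hd : 0 < d) :
    Γ < p.PTX * p.pathGain i d * p.G * g / (p.NF * p.σ ^ 2) ↔ p.ζ Γ i d < g := by
  have hC := p.C_pos i
  have hP := p.PTX_pos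
  have hN := p.NF_pos
  have hσ := p.σ_pos
  have hG : 0 < p.G := mul_pos (Nat.cast_pos.2 p.nUAV_pos) (Nat.cast_pos.2 p.nUE_pos)
  have hd' := Real.rpow_pos_of_pos hd (p.a i)
  rw [pathGain, ζ, Real.rpow_neg hd.le, lt_div_iff₀ (by positivity), div_mul_eq_mul_div,
    div_lt_iff₀ (by positivity)]
  have : p.PTX * (p.C i * (d ^ p.a i)⁻¹) * p.G * g = p.PTX * p.C i * p.G * g / d ^ p.a i := by
    field_simp
  rw [this, lt_div_iff₀ hd']
  constructor <;> intro h <;> linarith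

theorem ζ_nonneg {Γ r : ℝ} (hΓ : 0 ≤ Γ) (i : LinkState) (hr : 0 ≤ r) : 0 ≤ p.ζ Γ i r := by
  have hC := p.C_pos i
  have hP := p.PTX_pos
  have hN := p.NF_pos
  have hG : 0 < p.G := mul_pos (Nat.cast_pos.2 p.nUAV_pos) (Nat.cast_pos.2 p.nUE_pos)
  have hr' := Real.rpow_nonneg hr (p.a i)
  unfold ζ
  positivity

theorem measurable_ζ (Γ : ℝ) (i : LinkState) : Measurable (p.ζ Γ i) := by
  unfold ζ; fun_prop

theorem stateProbHor_b {r : ℝ} (i : LinkState) (hr : p.h ≤ r) :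
    p.stateProbHor i (p.b r) = p.stateProb i r := by
  rw [stateProbHor, b, Real.sq_sqrt (sub_nonneg.2 (pow_le_pow_left₀ p.h_nonneg hr 2)),
    sub_add_cancel, Real.sqrt_sq (p.h_nonneg.trans hr)]

end NetworkParams

/-! ### Null sets and pairs of points of a Poisson process -/

theorem IsPoissonPointProcess.ae_forall_notMem {Ω E : Type*} [MeasurableSpace Ω]
    [MeasurableSpace E] {X : ℕ → Ω → E} {Λ : Measure E} {P : Measure Ω} [IsProbabilityMeasure P]
    (hX : IsPoissonPointProcess X Λ P) {A : Set E} (hA : MeasurableSet A) (h0 : Λ A = 0) :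
    ∀ᵐ ω ∂P, ∀ n, X n ω ∉ A := by
  have h := hX.count_law A hA (by simp [h0]) 0
  have hm := measurable_pointCount hX.measurable hA (measurableSet_singleton 0)
  have h1 : P (pointCount X A ⁻¹' {0}) = 1 := by
    have : (pointCount X A ⁻¹' {0}) = {ω | pointCount X A ω = (0 : ℕ)} := by ext; simp
    rw [this, h, h0, poissonMeasure_singleton]; simp
  filter_upwards [(prob_compl_eq_zero_iff hm).2 h1] with ω hω n hn
  have h2 : {n | X n ω ∈ A} = ∅ := Set.encard_eq_zero.1 hω
  exact (h2 ▸ hn : n ∈ (∅ : Set ℕ))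

/-- Two or more points in `A` have probability of second order. -/
theorem IsPoissonPointProcess.measureReal_two_points_le {Ω E : Type*} [MeasurableSpace Ω]
    [MeasurableSpace E] {X : ℕ → Ω → E} {Λ : Measure E} {P : Measure Ω} [IsProbabilityMeasure P]
    (hX : IsPoissonPointProcess X Λ P) {A : Set E} (hA : MeasurableSet A) (hΛ : Λ A ≠ ⊤) :
    P.real {ω | ∃ n k, n ≠ k ∧ X n ω ∈ A ∧ X k ω ∈ A} ≤ Λ.real A ^ 2 := by
  set a := Λ.real A with ha
  have ha0 : 0 ≤ a := measureReal_nonneg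
  have hk : ∀ k : ℕ, P.real {ω | pointCount X A ω = k} =
      Real.exp (-a) * a ^ k / (k.factorial : ℝ) := fun k => by
    rw [measureReal_def, hX.count_law A hA hΛ, ← measureReal_def, poissonMeasure_real_singleton]
    rfl
  have hcm := measurable_pointCount hX.measurable hA
  have hm : ∀ k : ℕ, MeasurableSet {ω | pointCount X A ω = k} := fun k =>
    hcm (measurableSet_singleton (k : ℕ∞))
  have hdisj : Disjoint {ω | pointCount X A ω = (0 : ℕ)} {ω | pointCount X A ω = (1 : ℕ)} := by
    refine Set.disjoint_left.2 fun ω h0 h1 => ?_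
    have h0' : pointCount X A ω = (0 : ℕ) := h0
    have h1' : pointCount X A ω = (1 : ℕ) := h1
    exact absurd (h0'.symm.trans h1') (by simp)
  have hsub : {ω | ∃ n k, n ≠ k ∧ X n ω ∈ A ∧ X k ω ∈ A} ⊆
      ({ω | pointCount X A ω = (0 : ℕ)} ∪ {ω | pointCount X A ω = (1 : ℕ)})ᶜ := by
    rintro ω ⟨n, k, hnk, hn, hk⟩ (h | h)
    · have h2 : {n | X n ω ∈ A} = ∅ := Set.encard_eq_zero.1 h
      exact (h2 ▸ hn : n ∈ (∅ : Set ℕ))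
    · obtain ⟨l, hl⟩ := Set.encard_eq_one.1 h
      have hn' : n ∈ {n | X n ω ∈ A} := hn
      have hk' : k ∈ {n | X n ω ∈ A} := hk
      rw [hl] at hn' hk'
      exact hnk ((Set.mem_singleton_iff.1 hn').trans (Set.mem_singleton_iff.1 hk').symm)
  refine (measureReal_mono hsub).trans ?_
  rw [probReal_compl_eq_one_sub ((hm 0).union (hm 1)), measureReal_union hdisj (hm 1), hk, hk]
  -- The complement of zero or one point has probability 1 - e^{-a}(1+a) ≤ 1 - (1-a)(1+a) = a².
  have h1 := Real.add_one_le_exp (-a)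
  simp only [pow_zero, pow_one, Nat.factorial, Nat.cast_one, mul_one, div_one]
  nlinarith [mul_le_mul_of_nonneg_right h1 (by linarith : (0:ℝ) ≤ 1 + a)]

/-! ### Hitting and avoiding regions of marked UAVs -/

namespace NetworkParams

variable {p : NetworkParams} {Ω : Type*}

/-- The `n`-th UAV with its state and fading as marks. -/
def markedPoint (pos : ℕ → Ω → EuclideanSpace ℝ (Fin 2)) (state : ℕ → Ω → LinkState)
    (fading : ℕ → Ω → ℝ) (n : ℕ) (ω : Ω) : EuclideanSpace ℝ (Fin 2) × (LinkState × ℝ) :=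
  (pos n ω, state n ω, fading n ω)

variable [MeasurableSpace Ω] {P : Measure Ω}
  {pos : ℕ → Ω → EuclideanSpace ℝ (Fin 2)} {state : ℕ → Ω → LinkState} {fading : ℕ → Ω → ℝ}

namespace IsUAVNetwork

theorem measurable_markedPoint (hnet : p.IsUAVNetwork P pos state fading) (n : ℕ) :
    Measurable (markedPoint pos state fading n) :=
  (hnet.poisson.measurable n).prodMk (hnet.marking.measurable n)

theorem measurableSet_hit (hnet : p.IsUAVNetwork P pos state fading)
    {B : Set (EuclideanSpace ℝ (Fin 2) × (LinkState × ℝ))} (hB : MeasurableSet B) :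
    MeasurableSet {ω | ∃ n, markedPoint pos state fading n ω ∈ B} := by
  have : MeasurableSet (⋃ n, markedPoint pos state fading n ⁻¹' B) :=
    .iUnion fun n => hnet.measurable_markedPoint n hB
  convert this using 1
  ext ω; simp

variable [IsProbabilityMeasure P]

theorem measureReal_avoid (hnet : p.IsUAVNetwork P pos state fading)
    {B : Set (EuclideanSpace ℝ (Fin 2) × (LinkState × ℝ))} (hB : MeasurableSet B) {R : ℝ}
    (hR : ∀ q ∈ B, p.dist q.1 ≤ R) :
    P.real {ω | ∀ n, markedPoint pos state fading n ω ∉ B} =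
      Real.exp (-p.markedIntensity.real B) :=
  IsIndependentMarking.measureReal_forall_notMem (K := p.markKernel) (Λ := p.groundIntensity)
    hnet.poisson hnet.marking (p.measurableSet_dist_le R) (p.groundIntensity_dist_le_ne_top R) hB
    fun q hq => ⟨hR q hq, trivial⟩

/-- The event is "`V` is empty" minus "`V ∪ G` is empty", so void probabilities and additivity of
the intensity suffice. -/
theorem measureReal_avoid_hit (hnet : p.IsUAVNetwork P pos state fading)
    {V G : Set (EuclideanSpace ℝ (Fin 2) × (LinkState × ℝ))} (hV : MeasurableSet V)
    (hG : MeasurableSet G) (hVG : Disjoint V G) {R : ℝ} (hVR : ∀ q ∈ V, p.dist q.1 ≤ R)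
    (hGR : ∀ q ∈ G, p.dist q.1 ≤ R) (hV' : p.markedIntensity V ≠ ⊤)
    (hG' : p.markedIntensity G ≠ ⊤) :
    P.real {ω | (∀ n, markedPoint pos state fading n ω ∉ V) ∧
        ∃ n, markedPoint pos state fading n ω ∈ G} =
      Real.exp (-p.markedIntensity.real V) * (1 - Real.exp (-p.markedIntensity.real G)) := by
  have h1 := hnet.measureReal_avoid hV hVR
  have h2 := hnet.measureReal_avoid (hV.union hG) (R := R) (by
    rintro q (hq | hq)
    exacts [hVR q hq, hGR q hq])
  rw [measureReal_union hVG hG hV' hG'] at h2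
  have h3 : {ω | (∀ n, markedPoint pos state fading n ω ∉ V) ∧
      ∃ n, markedPoint pos state fading n ω ∈ G} =
      {ω | ∀ n, markedPoint pos state fading n ω ∉ V} \
        {ω | ∀ n, markedPoint pos state fading n ω ∉ V ∪ G} := by
    ext ω
    simp only [Set.mem_ofPred_eq, Set.mem_sdiff, Set.mem_union, not_or, not_forall]
    constructor
    · rintro ⟨ha, n, hn⟩
      exact ⟨ha, n, fun h => h.2 hn⟩
    · rintro ⟨ha, n, hn⟩
      exact ⟨ha, n, by_contra fun h => hn ⟨ha n, h⟩⟩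
  have h4 : MeasurableSet {ω | ∀ n, markedPoint pos state fading n ω ∉ V ∪ G} := by
    convert (hnet.measurableSet_hit (hV.union hG)).compl using 1
    ext ω; simp
  have h5 : {ω | ∀ n, markedPoint pos state fading n ω ∉ V ∪ G} ⊆
      {ω | ∀ n, markedPoint pos state fading n ω ∉ V} := fun ω hω n hn => hω n (Or.inl hn)
  rw [h3, measureReal_sdiff h5 h4, h1, h2, neg_add, Real.exp_add]
  ring

theorem measureReal_hit (hnet : p.IsUAVNetwork P pos state fading)
    {G : Set (EuclideanSpace ℝ (Fin 2) × (LinkState × ℝ))}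
    (hG : MeasurableSet G) {R : ℝ} (hGR : ∀ q ∈ G, p.dist q.1 ≤ R)
    (hG' : p.markedIntensity G ≠ ⊤) :
    P.real {ω | ∃ n, markedPoint pos state fading n ω ∈ G} =
      1 - Real.exp (-p.markedIntensity.real G) := by
  simpa using hnet.measureReal_avoid_hit (V := ∅) .empty hG (Set.empty_disjoint _) (R := R)
    (by simp) hGR (by simp) hG'

/-- The exact probability is (1 - e^{-v})(1 - e^{-g}), and 1 - e^{-x} ≤ x. This bounds ties between
UAVs in opposite states. -/
theorem measureReal_hit_hit_le (hnet : p.IsUAVNetwork P pos state fading)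
    {V G : Set (EuclideanSpace ℝ (Fin 2) × (LinkState × ℝ))} (hV : MeasurableSet V)
    (hG : MeasurableSet G) (hVG : Disjoint V G) {R : ℝ} (hVR : ∀ q ∈ V, p.dist q.1 ≤ R)
    (hGR : ∀ q ∈ G, p.dist q.1 ≤ R) (hV' : p.markedIntensity V ≠ ⊤)
    (hG' : p.markedIntensity G ≠ ⊤) :
    P.real {ω | (∃ n, markedPoint pos state fading n ω ∈ V) ∧
        ∃ n, markedPoint pos state fading n ω ∈ G} ≤
      p.markedIntensity.real V * p.markedIntensity.real G := by
  have h1 := hnet.measureReal_hit hG hGR hG'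
  have h2 := hnet.measureReal_avoid_hit hV hG hVG hVR hGR hV' hG'
  have h3 : {ω | (∃ n, markedPoint pos state fading n ω ∈ V) ∧
      ∃ n, markedPoint pos state fading n ω ∈ G} =
      {ω | ∃ n, markedPoint pos state fading n ω ∈ G} \
        {ω | (∀ n, markedPoint pos state fading n ω ∉ V) ∧
          ∃ n, markedPoint pos state fading n ω ∈ G} := by
    ext ω
    simp only [Set.mem_ofPred_eq, Set.mem_sdiff]
    constructor
    · rintro ⟨⟨n, hn⟩, hg⟩
      exact ⟨hg, fun h => h.1 n hn⟩
    · rintro ⟨hg, h⟩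
      exact ⟨by_contra fun hc => h ⟨fun n hn => hc ⟨n, hn⟩, hg⟩, hg⟩
  have h4 : MeasurableSet {ω | (∀ n, markedPoint pos state fading n ω ∉ V) ∧
      ∃ n, markedPoint pos state fading n ω ∈ G} := by
    convert (hnet.measurableSet_hit hV).compl.inter (hnet.measurableSet_hit hG) using 1
    ext ω; simp
  have h5 : {ω | (∀ n, markedPoint pos state fading n ω ∉ V) ∧
      ∃ n, markedPoint pos state fading n ω ∈ G} ⊆
      {ω | ∃ n, markedPoint pos state fading n ω ∈ G} := fun ω hω => hω.2
  rw [h3, measureReal_sdiff h5 h4, h1, h2]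
  have hv : 0 ≤ p.markedIntensity.real V := measureReal_nonneg
  have hg : 0 ≤ p.markedIntensity.real G := measureReal_nonneg
  have e1 := Real.add_one_le_exp (-p.markedIntensity.real V)
  have e2 := Real.add_one_le_exp (-p.markedIntensity.real G)
  have e3 : Real.exp (-p.markedIntensity.real V) ≤ 1 := Real.exp_le_one_iff.2 (by linarith)
  have e4 : Real.exp (-p.markedIntensity.real G) ≤ 1 := Real.exp_le_one_iff.2 (by linarith)
  calc _ = (1 - Real.exp (-p.markedIntensity.real V)) *
        (1 - Real.exp (-p.markedIntensity.real G)) := by ring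
    _ ≤ _ := mul_le_mul (by linarith) (by linarith) (by linarith) hv

/-- The origin has intensity zero. Strictness makes all distances positive even if h = 0, so that
path gains compare as they should, and lets the half-open ranges (h, R] miss no UAV. -/
theorem ae_h_lt_dist (hnet : p.IsUAVNetwork P pos state fading) :
    ∀ᵐ ω ∂P, ∀ n, p.h < p.dist (pos n ω) := by
  have h0 : p.groundIntensity {0} = 0 := by simp [groundIntensity]
  filter_upwards [hnet.poisson.ae_forall_notMem (measurableSet_singleton 0) h0] with ω hω n
  exact p.h_lt_dist (hω n)

theorem ae_dist_pos (hnet : p.IsUAVNetwork P pos state fading) :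
    ∀ᵐ ω ∂P, ∀ n, 0 < p.dist (pos n ω) :=
  hnet.ae_h_lt_dist.mono fun _ hω n => p.h_nonneg.trans_lt (hω n)

theorem ae_finite_dist_le (hnet : p.IsUAVNetwork P pos state fading) :
    ∀ᵐ ω ∂P, ∀ R : ℝ, {n | p.dist (pos n ω) ≤ R}.Finite := by
  have h : ∀ᵐ ω ∂P, ∀ N : ℕ, {n | pos n ω ∈ {x | p.dist x ≤ N}}.Finite :=
    ae_all_iff.2 fun N => hnet.poisson.ae_finite (p.measurableSet_dist_le N)
      (p.groundIntensity_dist_le_ne_top N)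
  filter_upwards [h] with ω hω R
  obtain ⟨N, hN⟩ := exists_nat_ge R
  exact (hω N).subset fun n hn => le_trans (show p.dist (pos n ω) ≤ R from hn) hN

end IsUAVNetwork

/-! ### Bounds on intensities -/

variable (p) in
/-- Intensity, at distance `r`, of the UAVs in state `i` whose fading exceeds `z r`. -/
noncomputable def linkDensity (z : ℝ → ℝ) (i : LinkState) (r : ℝ) : ℝ :=
  2 * Real.pi * p.lam * r * p.stateProb i r *
    (nakagamiMeasure (p.m i) (p.spread i)).real (Set.Ioi (z r))

theorem measurable_linkDensity {z : ℝ → ℝ} (hz : Measurable z) (i : LinkState) :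
    Measurable (p.linkDensity z i) := by
  have h1 : Measurable fun y : ℝ => (nakagamiMeasure (p.m i) (p.spread i)).real (Set.Ioi y) :=
    Antitone.measurable fun a b hab => measureReal_mono (Set.Ioi_subset_Ioi hab)
  have h2 := p.measurable_stateProb i
  have h3 := h1.comp hz
  unfold linkDensity
  exact ((measurable_const.mul measurable_id).mul h2).mul h3

theorem linkDensity_nonneg (z : ℝ → ℝ) (i : LinkState) {r : ℝ} (hr : 0 ≤ r) :
    0 ≤ p.linkDensity z i r := by
  have := p.lam_pos
  have := p.stateProb_nonneg i r
  have := Real.pi_pos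
  unfold linkDensity
  positivity

theorem linkDensity_le (z : ℝ → ℝ) (i : LinkState) {r R : ℝ} (hr : 0 ≤ r) (hR : r ≤ R) :
    p.linkDensity z i r ≤ 2 * Real.pi * p.lam * R := by
  have hl := p.lam_pos
  have h0 := p.stateProb_nonneg i r
  have h1 := p.stateProb_le_one i r
  have hπ := Real.pi_pos
  have hR0 := hr.trans hR
  have h2 : (nakagamiMeasure (p.m i) (p.spread i)).real (Set.Ioi (z r)) ≤ 1 := measureReal_le_one
  calc p.linkDensity z i r ≤ 2 * Real.pi * p.lam * R * 1 * 1 := by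
        unfold linkDensity; gcongr
    _ = _ := by ring

theorem intervalIntegrable_linkDensity {z : ℝ → ℝ} (hz : Measurable z) (i : LinkState) {s t : ℝ}
    (hs : 0 ≤ s) (hst : s ≤ t) : IntervalIntegrable (p.linkDensity z i) volume s t := by
  rw [intervalIntegrable_iff_integrableOn_Ioc_of_le hst]
  refine Integrable.of_bound (measurable_linkDensity hz i).aestronglyMeasurable
    (2 * Real.pi * p.lam * t) ?_
  filter_upwards [ae_restrict_mem measurableSet_Ioc] with r hr
  rw [Real.norm_of_nonneg (linkDensity_nonneg z i (hs.trans hr.1.le))]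
  exact linkDensity_le z i (hs.trans hr.1.le) hr.2

theorem integral_linkDensity_le {z : ℝ → ℝ} (hz : Measurable z) (i : LinkState) {s t R : ℝ}
    (hs : 0 ≤ s) (hst : s ≤ t) (htR : t ≤ R) :
    ∫ r in s..t, p.linkDensity z i r ≤ 2 * Real.pi * p.lam * R * (t - s) := by
  calc ∫ r in s..t, p.linkDensity z i r ≤ ∫ _ in s..t, 2 * Real.pi * p.lam * R :=
        intervalIntegral.integral_mono_on hst (intervalIntegrable_linkDensity hz i hs hst)
          intervalIntegrable_const fun r hr => linkDensity_le z i (hs.trans hr.1) (hr.2.trans htR)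
    _ = _ := by rw [intervalIntegral.integral_const, smul_eq_mul, mul_comm]

theorem meanCount_mono (i : LinkState) {s t : ℝ} (hs : 0 ≤ s) (hst : s ≤ t) :
    p.meanCount i s ≤ p.meanCount i t := by
  rw [← markedIntensity_real_region_le i hs, ← markedIntensity_real_region_le i (hs.trans hst)]
  refine measureReal_mono (fun q hq => ⟨hq.1, le_trans (show p.dist q.1 ≤ s from hq.2) hst⟩) ?_
  exact markedIntensity_region_ne_top (R := t) fun q hq => hq

theorem markedIntensity_real_annulus (i : LinkState) {s t : ℝ} (hs : 0 ≤ s) (hst : s ≤ t) :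
    p.markedIntensity.real (p.region i {q | s < q.1 ∧ q.1 ≤ t}) =
      p.meanCount i t - p.meanCount i s := by
  have hsub : p.region i {q | q.1 ≤ s} ⊆ p.region i {q | q.1 ≤ t} := fun q hq =>
    ⟨hq.1, le_trans (show p.dist q.1 ≤ s from hq.2) hst⟩
  rw [← markedIntensity_real_region_le i hs, ← markedIntensity_real_region_le i (hs.trans hst),
    ← measureReal_sdiff hsub
      (measurableSet_region (measurableSet_fst_le _))
      (markedIntensity_region_ne_top (R := t) fun q hq => hq)]
  congr 1
  ext q
  simp only [region, Set.mem_ofPred_eq, Set.mem_sdiff, not_and, not_le]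
  tauto

theorem groundIntensity_real_annulus {s t : ℝ} (hs : p.h ≤ s) (hst : s ≤ t) :
    p.groundIntensity.real {x | s < p.dist x ∧ p.dist x ≤ t} =
      Real.pi * p.lam * (t ^ 2 - s ^ 2) := by
  have hm : MeasurableSet {x | s < p.dist x ∧ p.dist x ≤ t} :=
    (measurableSet_lt measurable_const p.measurable_dist).inter (p.measurableSet_dist_le t)
  rw [← integral_indicator_one hm]
  have h := p.integral_indicator_Ioc_comp_dist (fun _ => 1) hs hst
  refine Eq.trans ?_ (h.trans ?_)
  · rfl
  · simp only [mul_one, integral_id]; ring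

theorem markedIntensity_real_annulus_le (i : LinkState) {s t : ℝ} (hs : p.h ≤ s) (hst : s ≤ t) :
    p.markedIntensity.real (p.region i {q | s < q.1 ∧ q.1 ≤ t}) ≤
      Real.pi * p.lam * (t ^ 2 - s ^ 2) := by
  have hm : MeasurableSet {x | s < p.dist x ∧ p.dist x ≤ t} :=
    (measurableSet_lt measurable_const p.measurable_dist).inter (p.measurableSet_dist_le t)
  rw [← groundIntensity_real_annulus hs hst]
  refine ENNReal.toReal_mono ?_ ?_
  · exact ((measure_mono fun x hx => hx.2).trans_lt
      (p.groundIntensity_dist_le_ne_top t).lt_top).ne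
  · rw [← markedIntensity_prod_univ hm]
    exact measure_mono fun q hq => ⟨hq.2, trivial⟩

end NetworkParams

/-! ### Two-sided bounds for the serving UAV in a thin annulus -/

namespace NetworkParams

variable {p : NetworkParams} {Ω : Type*}
  {pos : ℕ → Ω → EuclideanSpace ℝ (Fin 2)} {state : ℕ → Ω → LinkState} {fading : ℕ → Ω → ℝ}

variable (p) in
/-- Mean number of UAVs whose path gain is at least `ℓ_i(t)`. -/
noncomputable def meanCountGain (i : LinkState) (t : ℝ) : ℝ :=
  p.meanCount i t + p.meanCount i.opp (p.A i t)

variable (p) in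
/-- Marked points whose path gain is at least `ℓ_i(t)`. -/
def gainRegion (i : LinkState) (t : ℝ) : Set (EuclideanSpace ℝ (Fin 2) × (LinkState × ℝ)) :=
  p.region i {q | q.1 ≤ t} ∪ p.region i.opp {q | q.1 ≤ p.A i t}

theorem meanCountGain_mono (i : LinkState) {s t : ℝ} (hs : 0 ≤ s) (hst : s ≤ t) :
    p.meanCountGain i s ≤ p.meanCountGain i t :=
  add_le_add (meanCount_mono i hs hst) (meanCount_mono _ (A_nonneg i hs) (A_mono i hs hst))

theorem meanCount_nonneg (i : LinkState) {t : ℝ} (ht : 0 ≤ t) : 0 ≤ p.meanCount i t := by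
  rw [← markedIntensity_real_region_le i ht]; exact measureReal_nonneg

theorem meanCountGain_nonneg (i : LinkState) {t : ℝ} (ht : 0 ≤ t) : 0 ≤ p.meanCountGain i t :=
  add_nonneg (meanCount_nonneg i ht) (meanCount_nonneg _ (A_nonneg i ht))

theorem measurableSet_gainRegion (i : LinkState) (t : ℝ) : MeasurableSet (p.gainRegion i t) :=
  (measurableSet_region (measurableSet_fst_le _)).union
    (measurableSet_region (measurableSet_fst_le _))

theorem dist_le_of_mem_gainRegion (i : LinkState) (t : ℝ) :
    ∀ q ∈ p.gainRegion i t, p.dist q.1 ≤ max t (p.A i t) := by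
  rintro q (hq | hq)
  · exact le_trans (show p.dist q.1 ≤ t from hq.2) (le_max_left _ _)
  · exact le_trans (show p.dist q.1 ≤ p.A i t from hq.2) (le_max_right _ _)

theorem markedIntensity_region_le_ne_top (i : LinkState) (t : ℝ) :
    p.markedIntensity (p.region i {q | q.1 ≤ t}) ≠ ⊤ :=
  markedIntensity_region_ne_top (R := t) fun _ hq => hq

theorem markedIntensity_gainRegion_ne_top (i : LinkState) (t : ℝ) :
    p.markedIntensity (p.gainRegion i t) ≠ ⊤ :=
  (measure_union_lt_top (markedIntensity_region_le_ne_top i t).lt_top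
    (markedIntensity_region_le_ne_top i.opp (p.A i t)).lt_top).ne

theorem markedIntensity_real_gainRegion (i : LinkState) {t : ℝ} (ht : 0 ≤ t) :
    p.markedIntensity.real (p.gainRegion i t) = p.meanCountGain i t := by
  rw [gainRegion, measureReal_union (disjoint_region_opp i _ _)
    (measurableSet_region (measurableSet_fst_le _))
    (markedIntensity_region_le_ne_top i t) (markedIntensity_region_le_ne_top i.opp (p.A i t)),
    markedIntensity_real_region_le i ht, markedIntensity_real_region_le _ (A_nonneg i ht)]
  rfl

variable (p pos state fading) in
/-- The serving UAV is in state `i`, at a distance `d ∈ (s, t]`, with fading above `z d`. -/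
def servingEvent (z : ℝ → ℝ) (i : LinkState) (s t : ℝ) : Set Ω :=
  {ω | ∃ n, p.IsServing pos state n ω ∧ state n ω = i ∧
    (s < p.dist (pos n ω) ∧ p.dist (pos n ω) ≤ t) ∧ z (p.dist (pos n ω)) < fading n ω}

theorem gainOf_eq (n : ℕ) (ω : Ω) {i : LinkState} (h : state n ω = i) :
    p.gainOf pos state n ω = p.pathGain i (p.dist (pos n ω)) := by rw [gainOf, h]

variable [MeasurableSpace Ω] {P : Measure Ω} [IsProbabilityMeasure P]

namespace IsUAVNetwork

/-- A serving UAV in state i beyond distance s leaves no UAV with gain at least ℓ_i(s), while the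
annulus with large fading is hit. These regions are disjoint, and 1 - e^{-x} ≤ x. -/
theorem measureReal_servingEvent_le (hnet : p.IsUAVNetwork P pos state fading) {z : ℝ → ℝ}
    (hz : Measurable z) (i : LinkState) {s t : ℝ} (hs : p.h ≤ s) (hst : s ≤ t) :
    P.real (p.servingEvent pos state fading z i s t) ≤
      Real.exp (-p.meanCountGain i s) * ∫ r in s..t, p.linkDensity z i r := by
  have hs0 := p.h_nonneg.trans hs
  set D : Set (ℝ × ℝ) := {q | (s < q.1 ∧ q.1 ≤ t) ∧ z q.1 < q.2} with hD
  have hDm : MeasurableSet D := measurableSet_annulus_fading s t hz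
  have hGint : p.markedIntensity.real (p.region i D) = ∫ r in s..t, p.linkDensity z i r :=
    markedIntensity_real_region_Ioc i hs hst hz
  have hdisj : Disjoint (p.gainRegion i s) (p.region i D) := by
    refine Set.disjoint_union_left.2 ⟨disjoint_region ?_, (disjoint_region_opp i _ _).symm⟩
    exact Set.disjoint_left.2 fun q hq hq' => not_lt.2 hq hq'.1.1
  have key := hnet.measureReal_avoid_hit (measurableSet_gainRegion i s) (measurableSet_region hDm)
    hdisj (R := max t (max s (p.A i s)))
    (fun q hq => (dist_le_of_mem_gainRegion i s q hq).trans (le_max_right _ _))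
    (fun q hq => le_trans hq.2.1.2 (le_max_left _ _)) (markedIntensity_gainRegion_ne_top i s)
    (markedIntensity_region_ne_top (R := t) fun q hq => hq.1.2)
  rw [markedIntensity_real_gainRegion i hs0, hGint] at key
  have hle : P.real (p.servingEvent pos state fading z i s t) ≤
      P.real {ω | (∀ n, markedPoint pos state fading n ω ∉ p.gainRegion i s) ∧
        ∃ n, markedPoint pos state fading n ω ∈ p.region i D} := by
    refine ENNReal.toReal_mono (measure_ne_top _ _) (measure_mono_ae ?_)
    filter_upwards [hnet.ae_dist_pos] with ω hpos
    rintro ⟨n, hn, hi, hd, hf⟩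
    refine ⟨?_, n, hi, hd, hf⟩
    rintro k (hk | hk)
    · have hk1 : state k ω = i := hk.1
      have hk2 : p.dist (pos k ω) ≤ s := hk.2
      have h := hn k
      rw [gainOf_eq k ω hk1, gainOf_eq n ω hi, pathGain_le_iff (hpos k) (hpos n)] at h
      linarith [hd.1]
    · have hk1 : state k ω = i.opp := hk.1
      have hk2 : p.dist (pos k ω) ≤ p.A i s := hk.2
      have h := hn k
      rw [gainOf_eq k ω hk1, gainOf_eq n ω hi, pathGain_opp_le_iff (hpos k) (hpos n)] at h
      linarith [A_lt (p := p) i hs0 hd.1]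
  refine hle.trans (key.le.trans ?_)
  refine mul_le_mul_of_nonneg_left ?_ (Real.exp_pos _).le
  linarith [Real.add_one_le_exp (-∫ r in s..t, p.linkDensity z i r)]

/-- If every UAV with gain at least ℓ_i(t) lies in the annulus with large fading and there is one,
then the nearest such UAV serves. With I the mean count in that region, this has probability
e^{-(M(t)-I)}(1 - e^{-I}) = e^{-M(t)}(e^I - 1) ≥ e^{-M(t)} I. -/
theorem le_measureReal_servingEvent (hnet : p.IsUAVNetwork P pos state fading) {z : ℝ → ℝ}
    (hz : Measurable z) (i : LinkState) {s t : ℝ} (hs : p.h ≤ s) (hst : s ≤ t) :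
    Real.exp (-p.meanCountGain i t) * ∫ r in s..t, p.linkDensity z i r ≤
      P.real (p.servingEvent pos state fading z i s t) := by
  have hs0 := p.h_nonneg.trans hs
  have ht0 := hs0.trans hst
  set D : Set (ℝ × ℝ) := {q | (s < q.1 ∧ q.1 ≤ t) ∧ z q.1 < q.2} with hD
  have hDm : MeasurableSet D := measurableSet_annulus_fading s t hz
  have hGint : p.markedIntensity.real (p.region i D) = ∫ r in s..t, p.linkDensity z i r :=
    markedIntensity_real_region_Ioc i hs hst hz
  have hsub : p.region i D ⊆ p.gainRegion i t := fun q hq => Or.inl ⟨hq.1, hq.2.1.2⟩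
  have hVm : MeasurableSet (p.gainRegion i t \ p.region i D) :=
    (measurableSet_gainRegion i t).diff (measurableSet_region hDm)
  have hVint : p.markedIntensity.real (p.gainRegion i t \ p.region i D) =
      p.meanCountGain i t - ∫ r in s..t, p.linkDensity z i r := by
    rw [measureReal_sdiff hsub (measurableSet_region hDm) (markedIntensity_gainRegion_ne_top i t),
      hGint, markedIntensity_real_gainRegion i ht0]
  have key := hnet.measureReal_avoid_hit hVm (measurableSet_region hDm) Set.disjoint_sdiff_left
    (R := max t (p.A i t)) (fun q hq => dist_le_of_mem_gainRegion i t q hq.1)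
    (fun q hq => le_trans hq.2.1.2 (le_max_left _ _))
    ((measure_mono Set.sdiff_subset).trans_lt (markedIntensity_gainRegion_ne_top i t).lt_top).ne
    (markedIntensity_region_ne_top (R := t) fun q hq => hq.1.2)
  rw [hVint, hGint] at key
  have hle : P.real {ω | (∀ n, markedPoint pos state fading n ω ∉
        p.gainRegion i t \ p.region i D) ∧
        ∃ n, markedPoint pos state fading n ω ∈ p.region i D} ≤
      P.real (p.servingEvent pos state fading z i s t) := by
    refine ENNReal.toReal_mono (measure_ne_top _ _) (measure_mono_ae ?_)
    filter_upwards [hnet.ae_dist_pos, hnet.ae_finite_dist_le] with ω hpos hfin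
    rintro ⟨hV, n₀, hn₀⟩
    have hfinite : {n | markedPoint pos state fading n ω ∈ p.region i D}.Finite :=
      (hfin t).subset fun n hn => hn.2.1.2
    obtain ⟨n, hn, hmin⟩ := Set.exists_min_image _ (fun n => p.dist (pos n ω)) hfinite ⟨n₀, hn₀⟩
    have hn : markedPoint pos state fading n ω ∈ p.region i D := hn
    have hi : state n ω = i := hn.1
    have hd : s < p.dist (pos n ω) ∧ p.dist (pos n ω) ≤ t := hn.2.1
    refine ⟨n, fun k => ?_, hi, hd, hn.2.2⟩
    by_cases hk : markedPoint pos state fading k ω ∈ p.region i D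
    · rw [gainOf_eq k ω hk.1, gainOf_eq n ω hi, pathGain_le_iff (hpos k) (hpos n)]
      exact hmin k hk
    · have hk' : markedPoint pos state fading k ω ∉ p.gainRegion i t := fun h => hV k ⟨h, hk⟩
      rcases LinkState.eq_or_eq_opp i (state k ω) with hki | hki
      · rw [gainOf_eq k ω hki, gainOf_eq n ω hi, pathGain_le_iff (hpos k) (hpos n)]
        by_contra hlt
        exact hk' (Or.inl ⟨hki, (not_le.1 hlt).le.trans hd.2⟩)
      · rw [gainOf_eq k ω hki, gainOf_eq n ω hi, pathGain_opp_le_iff (hpos k) (hpos n)]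
        by_contra hlt
        exact hk' (Or.inr ⟨hki, (not_le.1 hlt).le.trans (A_mono i (hpos n).le hd.2)⟩)
  refine le_trans ?_ (key.symm.le.trans hle)
  rw [neg_sub, sub_eq_add_neg, add_comm, Real.exp_add, mul_assoc]
  refine mul_le_mul_of_nonneg_left ?_ (Real.exp_pos _).le
  rw [mul_sub, ← Real.exp_add, add_neg_cancel, Real.exp_zero, mul_one]
  linarith [Real.add_one_le_exp (∫ r in s..t, p.linkDensity z i r)]

/-! ### Uniqueness of the serving UAV -/

/-- Two UAVs at equal distance in (s,t] put two points into one annulus, which has probability at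
most the square of its mean count, of order (t-s)². Refinement gives probability zero. -/
theorem ae_dist_ne (hnet : p.IsUAVNetwork P pos state fading) :
    ∀ᵐ ω ∂P, ∀ n k, n ≠ k → p.dist (pos n ω) ≠ p.dist (pos k ω) := by
  let T : ℝ → ℝ → Set Ω := fun s t => {ω | ∃ n k, n ≠ k ∧
    (s < p.dist (pos n ω) ∧ p.dist (pos n ω) ≤ t) ∧ p.dist (pos n ω) = p.dist (pos k ω)}
  have hT : ∀ R : ℝ, p.h ≤ R → P (T p.h R) = 0 := by
    intro R hR
    have h0 := p.h_nonneg
    have hπ := Real.pi_pos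
    have hl := p.lam_pos
    suffices h : P.real (T p.h R) ≤ 0 from
      (measureReal_eq_zero_iff).1 (le_antisymm h measureReal_nonneg)
    refine nonpos_of_subadditive_of_le_mul (q := fun s t => P.real (T s t))
      (H := fun t => Real.pi * p.lam * t ^ 2) (C := Real.pi * p.lam * (2 * R)) hR ?_ ?_
    · intro s t u _ _ _ _
      refine (measureReal_mono ?_).trans (measureReal_union_le _ _)
      rintro ω ⟨n, k, hnk, hd, he⟩
      rcases le_or_gt (p.dist (pos n ω)) t with h | h
      · exact Or.inl ⟨n, k, hnk, ⟨hd.1, h⟩, he⟩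
      · exact Or.inr ⟨n, k, hnk, ⟨h, hd.2⟩, he⟩
    · intro s t hs hst htR
      have hm : MeasurableSet {x | s < p.dist x ∧ p.dist x ≤ t} :=
        (measurableSet_lt measurable_const p.measurable_dist).inter (p.measurableSet_dist_le t)
      have h1 := hnet.poisson.measureReal_two_points_le hm
        (((measure_mono fun x hx => hx.2).trans_lt
          (p.groundIntensity_dist_le_ne_top t).lt_top).ne)
      have h2 : P.real (T s t) ≤ p.groundIntensity.real {x | s < p.dist x ∧ p.dist x ≤ t} ^ 2 := by
        refine (measureReal_mono ?_).trans h1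
        rintro ω ⟨n, k, hnk, hd, he⟩
        have hd' : s < p.dist (pos k ω) ∧ p.dist (pos k ω) ≤ t := by rwa [← he]
        exact ⟨n, k, hnk, hd, hd'⟩
      rw [groundIntensity_real_annulus hs hst] at h2
      refine h2.trans ?_
      have h3 : 0 ≤ t ^ 2 - s ^ 2 := by nlinarith
      have h4 : t ^ 2 - s ^ 2 ≤ 2 * R * (t - s) := by nlinarith
      calc (Real.pi * p.lam * (t ^ 2 - s ^ 2)) ^ 2
          = (Real.pi * p.lam * (t ^ 2 - s ^ 2)) * (Real.pi * p.lam * (t ^ 2 - s ^ 2)) := sq _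
        _ ≤ (Real.pi * p.lam * (t ^ 2 - s ^ 2)) * (Real.pi * p.lam * (2 * R * (t - s))) := by
          gcongr
        _ = _ := by ring
  have hall : ∀ᵐ ω ∂P, ∀ N : ℕ, ω ∉ T p.h (p.h + N) :=
    ae_all_iff.2 fun N => measure_eq_zero_iff_ae_notMem.1 (hT _ (by simp))
  filter_upwards [hall, hnet.ae_h_lt_dist] with ω hω hne n k hnk he
  obtain ⟨N, hN⟩ := exists_nat_ge (p.dist (pos n ω))
  exact hω N ⟨n, k, hnk, ⟨hne n, hN.trans (le_add_of_nonneg_left p.h_nonneg)⟩, he⟩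

/-- A tie in gain between opposite states, with the first distance in (s,t], puts the other distance
in (A(s), A(t)]. The probability is at most the product of the two mean counts: one is an increment
of `H`, the other is O(t-s). -/
theorem ae_dist_ne_A (hnet : p.IsUAVNetwork P pos state fading) (i : LinkState) :
    ∀ᵐ ω ∂P, ∀ n k, state n ω = i → state k ω = i.opp →
      p.dist (pos k ω) ≠ p.A i (p.dist (pos n ω)) := by
  let T : ℝ → ℝ → Set Ω := fun s t => {ω | ∃ n k, state n ω = i ∧ state k ω = i.opp ∧
    (s < p.dist (pos n ω) ∧ p.dist (pos n ω) ≤ t) ∧ p.dist (pos k ω) = p.A i (p.dist (pos n ω))}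
  have hT : ∀ R : ℝ, p.h ≤ R → P (T p.h R) = 0 := by
    intro R hR
    have h0 := p.h_nonneg
    have hπ := Real.pi_pos
    have hl := p.lam_pos
    suffices h : P.real (T p.h R) ≤ 0 from
      (measureReal_eq_zero_iff).1 (le_antisymm h measureReal_nonneg)
    refine nonpos_of_subadditive_of_le_mul (q := fun s t => P.real (T s t))
      (H := fun t => p.meanCount i.opp (p.A i t)) (C := Real.pi * p.lam * (2 * R)) hR ?_ ?_
    · intro s t u _ _ _ _
      refine (measureReal_mono ?_).trans (measureReal_union_le _ _)
      rintro ω ⟨n, k, hn, hk, hd, he⟩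
      rcases le_or_gt (p.dist (pos n ω)) t with h | h
      · exact Or.inl ⟨n, k, hn, hk, ⟨hd.1, h⟩, he⟩
      · exact Or.inr ⟨n, k, hn, hk, ⟨h, hd.2⟩, he⟩
    · intro s t hs hst htR
      have hs0 := h0.trans hs
      have h1 := hnet.measureReal_hit_hit_le
        (measurableSet_region (p := p) (i := i.opp) (measurableSet_annulus (p.A i s) (p.A i t)))
        (measurableSet_region (p := p) (i := i) (measurableSet_annulus s t))
        (disjoint_region_opp i _ _).symm
        (R := max t (p.A i t)) (fun q hq => le_trans hq.2.2 (le_max_right _ _))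
        (fun q hq => le_trans hq.2.2 (le_max_left _ _))
        (markedIntensity_region_ne_top (R := p.A i t) fun q hq => hq.2)
        (markedIntensity_region_ne_top (R := t) fun q hq => hq.2)
      have h2 := (measureReal_mono (μ := P) (s₁ := T s t) (by
        rintro ω ⟨n, k, hn, hk, hd, he⟩
        refine ⟨⟨k, hk, ?_⟩, n, hn, hd⟩
        change p.A i s < p.dist (pos k ω) ∧ p.dist (pos k ω) ≤ p.A i t
        rw [he]
        exact ⟨A_lt i hs0 hd.1, A_mono i (hs0.trans hd.1.le) hd.2⟩)).trans h1
      refine h2.trans ?_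
      rw [markedIntensity_real_annulus _ (A_nonneg i hs0) (A_mono i hs0 hst)]
      refine mul_le_mul_of_nonneg_left ?_
        (sub_nonneg.2 (meanCount_mono _ (A_nonneg i hs0) (A_mono i hs0 hst)))
      refine (markedIntensity_real_annulus_le i hs hst).trans ?_
      rw [mul_assoc (Real.pi * p.lam)]
      refine mul_le_mul_of_nonneg_left ?_ (by positivity)
      nlinarith
  have hall : ∀ᵐ ω ∂P, ∀ N : ℕ, ω ∉ T p.h (p.h + N) :=
    ae_all_iff.2 fun N => measure_eq_zero_iff_ae_notMem.1 (hT _ (by simp))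
  filter_upwards [hall, hnet.ae_h_lt_dist] with ω hω hne n k hn hk he
  obtain ⟨N, hN⟩ := exists_nat_ge (p.dist (pos n ω))
  exact hω N ⟨n, k, hn, hk, ⟨hne n, hN.trans (le_add_of_nonneg_left p.h_nonneg)⟩, he⟩

theorem ae_isServing_unique (hnet : p.IsUAVNetwork P pos state fading) :
    ∀ᵐ ω ∂P, ∀ n k, p.IsServing pos state n ω → p.IsServing pos state k ω → n = k := by
  filter_upwards [hnet.ae_dist_pos, hnet.ae_dist_ne, hnet.ae_dist_ne_A .los,
    hnet.ae_dist_ne_A .nlos] with ω hpos h1 h2 h3 n k hn hk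
  have h4 : ∀ i, ∀ n k, state n ω = i → state k ω = i.opp →
      p.dist (pos k ω) ≠ p.A i (p.dist (pos n ω)) := by
    intro i; cases i
    exacts [h2, h3]
  have he : p.gainOf pos state k ω = p.gainOf pos state n ω := le_antisymm (hn k) (hk n)
  by_contra hnk
  rcases LinkState.eq_or_eq_opp (state n ω) (state k ω) with hs | hs
  · rw [gainOf_eq k ω hs, gainOf_eq n ω rfl] at he
    exact h1 n k hnk (le_antisymm ((pathGain_le_iff (hpos k) (hpos n)).1 he.le)
      ((pathGain_le_iff (hpos n) (hpos k)).1 he.ge))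
  · rw [gainOf_eq k ω hs, gainOf_eq n ω rfl, ← pathGain_opp_A _ (hpos n)] at he
    have hA := A_pos (p := p) (state n ω) (hpos n)
    exact h4 _ n k rfl hs (le_antisymm ((pathGain_le_iff hA (hpos k)).1 he.ge)
      ((pathGain_le_iff (hpos k) hA).1 he.le))

/-- UAVs at least as good as UAV 0 lie within a bounded distance, so there are finitely many, and a
maximum among them is global. -/
theorem ae_exists_isServing (hnet : p.IsUAVNetwork P pos state fading) :
    ∀ᵐ ω ∂P, ∃ n, p.IsServing pos state n ω := by
  filter_upwards [hnet.ae_dist_pos, hnet.ae_finite_dist_le] with ω hpos hfin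
  have hfinite : {n | p.gainOf pos state 0 ω ≤ p.gainOf pos state n ω}.Finite := by
    refine (hfin (max (p.dist (pos 0 ω)) (p.A (state 0 ω) (p.dist (pos 0 ω))))).subset ?_
    intro n hn
    have hn : p.gainOf pos state 0 ω ≤ p.gainOf pos state n ω := hn
    change p.dist (pos n ω) ≤ max (p.dist (pos 0 ω)) (p.A (state 0 ω) (p.dist (pos 0 ω)))
    by_contra hlt
    obtain ⟨h1, h2⟩ := max_lt_iff.1 (not_le.1 hlt)
    rcases LinkState.eq_or_eq_opp (state 0 ω) (state n ω) with hs | hs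
    · rw [gainOf_eq n ω hs, gainOf_eq 0 ω rfl, pathGain_le_iff (hpos 0) (hpos n)] at hn
      exact not_le.2 h1 hn
    · rw [gainOf_eq n ω hs, gainOf_eq 0 ω rfl, ← pathGain_opp_A _ (hpos 0),
        pathGain_le_iff (A_pos _ (hpos 0)) (hpos n)] at hn
      exact not_le.2 h2 hn
  obtain ⟨n, hn, hmax⟩ := Set.exists_max_image _ (fun n => p.gainOf pos state n ω) hfinite
    ⟨0, le_refl (p.gainOf pos state 0 ω)⟩
  refine ⟨n, fun k => ?_⟩
  rcases le_total (p.gainOf pos state 0 ω) (p.gainOf pos state k ω) with h | h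
  · exact hmax k h
  · exact h.trans hn

end IsUAVNetwork

end NetworkParams

/-! ### Exact law of the serving distance -/

namespace NetworkParams

variable {p : NetworkParams} {Ω : Type*}
  {pos : ℕ → Ω → EuclideanSpace ℝ (Fin 2)} {state : ℕ → Ω → LinkState} {fading : ℕ → Ω → ℝ}

variable (p) in
/-- Density of the distance of the serving UAV in state `i` with fading above the threshold. -/
noncomputable def servingDensity (z : ℝ → ℝ) (i : LinkState) (r : ℝ) : ℝ :=
  p.linkDensity z i r * Real.exp (-p.meanCountGain i r)

theorem servingDensity_nonneg (z : ℝ → ℝ) (i : LinkState) {r : ℝ} (hr : 0 ≤ r) :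
    0 ≤ p.servingDensity z i r :=
  mul_nonneg (linkDensity_nonneg z i hr) (Real.exp_pos _).le

theorem exp_neg_meanCountGain_anti (i : LinkState) {s t : ℝ} (hs : 0 ≤ s) (hst : s ≤ t) :
    Real.exp (-p.meanCountGain i t) ≤ Real.exp (-p.meanCountGain i s) :=
  Real.exp_le_exp.2 (neg_le_neg (meanCountGain_mono i hs hst))

theorem intervalIntegrable_servingDensity {z : ℝ → ℝ} (hz : Measurable z) (i : LinkState)
    {s t : ℝ} (hs : 0 ≤ s) (hst : s ≤ t) :
    IntervalIntegrable (p.servingDensity z i) volume s t := by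
  rw [intervalIntegrable_iff_integrableOn_Ioc_of_le hst]
  have h1 := (intervalIntegrable_iff_integrableOn_Ioc_of_le hst).1
    (intervalIntegrable_linkDensity (p := p) hz i hs hst)
  have hanti : AntitoneOn (fun r => Real.exp (-p.meanCountGain i r)) (Set.Ioc s t) :=
    fun a ha b _ hab => exp_neg_meanCountGain_anti i (hs.trans ha.1.le) hab
  refine h1.mul_bdd (c := 1)
    (aemeasurable_restrict_of_antitoneOn measurableSet_Ioc hanti).aestronglyMeasurable ?_
  filter_upwards [ae_restrict_mem measurableSet_Ioc] with r hr
  rw [Real.norm_of_nonneg (Real.exp_pos _).le]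
  exact Real.exp_le_one_iff.2 (neg_nonpos.2 (meanCountGain_nonneg i (hs.trans hr.1.le)))

theorem integral_servingDensity_le {z : ℝ → ℝ} (hz : Measurable z) (i : LinkState)
    {s t : ℝ} (hs : 0 ≤ s) (hst : s ≤ t) :
    ∫ r in s..t, p.servingDensity z i r ≤
      Real.exp (-p.meanCountGain i s) * ∫ r in s..t, p.linkDensity z i r := by
  rw [← intervalIntegral.integral_const_mul]
  refine intervalIntegral.integral_mono_on hst (intervalIntegrable_servingDensity hz i hs hst)
    ((intervalIntegrable_linkDensity hz i hs hst).const_mul _) fun r hr => ?_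
  rw [servingDensity, mul_comm]
  exact mul_le_mul_of_nonneg_right (exp_neg_meanCountGain_anti i hs hr.1)
    (linkDensity_nonneg z i (hs.trans hr.1))

theorem le_integral_servingDensity {z : ℝ → ℝ} (hz : Measurable z) (i : LinkState)
    {s t : ℝ} (hs : 0 ≤ s) (hst : s ≤ t) :
    Real.exp (-p.meanCountGain i t) * ∫ r in s..t, p.linkDensity z i r ≤
      ∫ r in s..t, p.servingDensity z i r := by
  rw [← intervalIntegral.integral_const_mul]
  refine intervalIntegral.integral_mono_on hst
    ((intervalIntegrable_linkDensity hz i hs hst).const_mul _)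
    (intervalIntegrable_servingDensity hz i hs hst) fun r hr => ?_
  rw [servingDensity, mul_comm]
  exact mul_le_mul_of_nonneg_left (exp_neg_meanCountGain_anti i (hs.trans hr.1) hr.2)
    (linkDensity_nonneg z i (hs.trans hr.1))

variable [MeasurableSpace Ω] {P : Measure Ω}

theorem IsUAVNetwork.measurable_gainOf (hnet : p.IsUAVNetwork P pos state fading) (n : ℕ) :
    Measurable (p.gainOf pos state n) := by
  have h : Measurable fun q : ℝ × LinkState => p.pathGain q.2 q.1 := by
    refine measurable_from_prod_countable_left fun i => ?_
    unfold pathGain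
    fun_prop
  exact h.comp ((p.measurable_dist.comp (hnet.poisson.measurable n)).prodMk
    (hnet.marking.measurable n).fst)

theorem IsUAVNetwork.measurableSet_servingEvent (hnet : p.IsUAVNetwork P pos state fading)
    {z : ℝ → ℝ} (hz : Measurable z) (i : LinkState) (s t : ℝ) :
    MeasurableSet (p.servingEvent pos state fading z i s t) := by
  have h : MeasurableSet (⋃ n, (⋂ k, {ω | p.gainOf pos state k ω ≤ p.gainOf pos state n ω}) ∩
      markedPoint pos state fading n ⁻¹'
        p.region i {q | (s < q.1 ∧ q.1 ≤ t) ∧ z q.1 < q.2}) := by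
    refine .iUnion fun n => .inter (.iInter fun k => ?_) ?_
    · exact measurableSet_le (hnet.measurable_gainOf k) (hnet.measurable_gainOf n)
    · exact hnet.measurable_markedPoint n
        (measurableSet_region (measurableSet_annulus_fading s t hz))
  convert h using 1
  ext ω
  simp [servingEvent, IsServing, markedPoint, region]

variable [IsProbabilityMeasure P]

namespace IsUAVNetwork

/-- Both sides are additive over adjacent intervals and lie between the same two bounds on each of
them. The gap between the bounds is of second order, so the refinement principle applies to the
difference with either sign. -/
theorem measureReal_servingEvent (hnet : p.IsUAVNetwork P pos state fading) {z : ℝ → ℝ}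
    (hz : Measurable z) (i : LinkState) {R : ℝ} (hR : p.h ≤ R) :
    P.real (p.servingEvent pos state fading z i p.h R) =
      ∫ r in p.h..R, p.servingDensity z i r := by
  have h0 := p.h_nonneg
  have hint : ∀ {s t u : ℝ}, p.h ≤ s → s ≤ t → t ≤ u →
      ∫ r in s..u, p.servingDensity z i r =
        (∫ r in s..t, p.servingDensity z i r) + ∫ r in t..u, p.servingDensity z i r :=
    fun hs hst htu => (intervalIntegral.integral_add_adjacent_intervals
      (intervalIntegrable_servingDensity hz i (h0.trans hs) hst)
      (intervalIntegrable_servingDensity hz i ((h0.trans hs).trans hst) htu)).symm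
  have hadd : ∀ {s t u : ℝ}, s ≤ t → t ≤ u →
      P.real (p.servingEvent pos state fading z i s u) =
        P.real (p.servingEvent pos state fading z i s t) +
          P.real (p.servingEvent pos state fading z i t u) := by
    intro s t u hst htu
    -- Additivity rests on uniqueness: two serving UAVs could otherwise lie in different annuli.
    have hdisj : AEDisjoint P (p.servingEvent pos state fading z i s t)
        (p.servingEvent pos state fading z i t u) := by
      refine measure_eq_zero_iff_ae_notMem.2 ?_
      filter_upwards [hnet.ae_isServing_unique] with ω hω
      rintro ⟨⟨n, hn, -, hd, -⟩, ⟨k, hk, -, hd', -⟩⟩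
      rw [hω n k hn hk] at hd
      exact not_lt.2 hd.2 hd'.1
    rw [← measureReal_union₀ (hnet.measurableSet_servingEvent hz i t u).nullMeasurableSet hdisj]
    congr 1
    ext ω
    constructor
    · rintro ⟨n, hn, hi, hd, hf⟩
      rcases le_or_gt (p.dist (pos n ω)) t with h | h
      · exact Or.inl ⟨n, hn, hi, ⟨hd.1, h⟩, hf⟩
      · exact Or.inr ⟨n, hn, hi, ⟨h, hd.2⟩, hf⟩
    · rintro (⟨n, hn, hi, hd, hf⟩ | ⟨n, hn, hi, hd, hf⟩)
      · exact ⟨n, hn, hi, ⟨hd.1, hd.2.trans htu⟩, hf⟩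
      · exact ⟨n, hn, hi, ⟨hst.trans_lt hd.1, hd.2⟩, hf⟩
  have hbound : ∀ s t, p.h ≤ s → s ≤ t → t ≤ R →
      (Real.exp (-p.meanCountGain i s) - Real.exp (-p.meanCountGain i t)) *
        ∫ r in s..t, p.linkDensity z i r ≤
      (-Real.exp (-p.meanCountGain i t) - -Real.exp (-p.meanCountGain i s)) *
        (2 * Real.pi * p.lam * R * (t - s)) := by
    intro s t hs hst htR
    rw [neg_sub_neg]
    exact mul_le_mul_of_nonneg_left (integral_linkDensity_le hz i (h0.trans hs) hst htR)
      (sub_nonneg.2 (exp_neg_meanCountGain_anti i (h0.trans hs) hst))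
  have hle := nonpos_of_subadditive_of_le_mul
    (q := fun s t => P.real (p.servingEvent pos state fading z i s t) -
      ∫ r in s..t, p.servingDensity z i r)
    (H := fun t => -Real.exp (-p.meanCountGain i t)) (C := 2 * Real.pi * p.lam * R) hR
    (fun s t u hs hst htu _ => by
      have := hint hs hst htu
      have := hadd hst htu
      linarith)
    (fun s t hs hst htR => by
      have h1 := hbound s t hs hst htR
      have h2 := hnet.measureReal_servingEvent_le hz i hs hst
      have h3 := le_integral_servingDensity (p := p) hz i (h0.trans hs) hst
      linarith)
  have hge := nonpos_of_subadditive_of_le_mul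
    (q := fun s t => (∫ r in s..t, p.servingDensity z i r) -
      P.real (p.servingEvent pos state fading z i s t))
    (H := fun t => -Real.exp (-p.meanCountGain i t)) (C := 2 * Real.pi * p.lam * R) hR
    (fun s t u hs hst htu _ => by
      have := hint hs hst htu
      have := hadd hst htu
      linarith)
    (fun s t hs hst htR => by
      have h1 := hbound s t hs hst htR
      have h2 := hnet.le_measureReal_servingEvent hz i hs hst
      have h3 := integral_servingDensity_le (p := p) hz i (h0.trans hs) hst
      linarith)
  linarith

/-- The density is nonnegative and its integrals over bounded intervals are probabilities, hence at
most 1. -/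
theorem integrableOn_servingDensity (hnet : p.IsUAVNetwork P pos state fading) {z : ℝ → ℝ}
    (hz : Measurable z) (i : LinkState) :
    IntegrableOn (p.servingDensity z i) (Set.Ioi p.h) := by
  have h0 := p.h_nonneg
  have htop : Tendsto (fun N : ℕ => p.h + N) atTop atTop :=
    tendsto_atTop_add_const_left _ _ tendsto_natCast_atTop_atTop
  have hle : ∀ N : ℕ, p.h ≤ p.h + N := fun N => le_add_of_nonneg_right N.cast_nonneg
  refine integrableOn_Ioi_of_intervalIntegral_norm_bounded 1 p.h (fun N => ?_) htop
    (.of_forall fun N => ?_)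
  · exact (intervalIntegrable_iff_integrableOn_Ioc_of_le (hle N)).1
      (intervalIntegrable_servingDensity hz i h0 (hle N))
  · rw [intervalIntegral.integral_congr (g := p.servingDensity z i),
      ← hnet.measureReal_servingEvent hz i (hle N)]
    · exact measureReal_le_one
    · intro r hr
      rw [Set.uIcc_of_le (hle N)] at hr
      exact Real.norm_of_nonneg (servingDensity_nonneg z i (h0.trans hr.1))

theorem measureReal_iUnion_servingEvent (hnet : p.IsUAVNetwork P pos state fading) {z : ℝ → ℝ}
    (hz : Measurable z) (i : LinkState) :
    P.real (⋃ N : ℕ, p.servingEvent pos state fading z i p.h (p.h + N)) =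
      ∫ r in Set.Ioi p.h, p.servingDensity z i r := by
  have htop : Tendsto (fun N : ℕ => p.h + N) atTop atTop :=
    tendsto_atTop_add_const_left _ _ tendsto_natCast_atTop_atTop
  have hle : ∀ N : ℕ, p.h ≤ p.h + N := fun N => le_add_of_nonneg_right N.cast_nonneg
  have hmono : Monotone fun N : ℕ => p.servingEvent pos state fading z i p.h (p.h + N) := by
    rintro N N' hN ω ⟨n, hn, hi, hd, hf⟩
    have : (N : ℝ) ≤ N' := Nat.cast_le.2 hN
    exact ⟨n, hn, hi, ⟨hd.1, hd.2.trans (by linarith)⟩, hf⟩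
  have h1 := (ENNReal.tendsto_toReal (measure_ne_top P _)).comp
    (tendsto_measure_iUnion_atTop (μ := P) hmono)
  have h2 := intervalIntegral_tendsto_integral_Ioi p.h
    (hnet.integrableOn_servingDensity hz i) htop
  refine tendsto_nhds_unique (h1.congr fun N => ?_) h2
  exact hnet.measureReal_servingEvent hz i (hle N)

end IsUAVNetwork

theorem mul_fbar_eq_servingDensity {Γ : ℝ} (hΓ : 0 ≤ Γ) (i : LinkState) {r : ℝ} (hr : p.h ≤ r) :
    (1 - (∫ t in (0 : ℝ)..p.Δ Γ i r, t ^ (p.m i - 1) * Real.exp (-t)) /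
      Real.Gamma (p.m i)) * p.fbar i r = p.servingDensity (p.ζ Γ i) i r := by
  have hr0 := p.h_nonneg.trans hr
  have hζ := ζ_nonneg (p := p) hΓ i hr0
  have hnak : (nakagamiMeasure (p.m i) (p.spread i)).real (Set.Ioi (p.ζ Γ i r)) =
      1 - (∫ t in (0 : ℝ)..p.Δ Γ i r, t ^ (p.m i - 1) * Real.exp (-t)) / Real.Gamma (p.m i) := by
    rw [measureReal_def, nakagamiMeasure_Ioi (p.m_pos i) (p.spread_pos i) hζ,
      ENNReal.toReal_ofReal]
    · rfl
    -- The tail formula is truncated by `ENNReal.ofReal`; removing this needs that the incomplete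
    -- gamma integral is at most Γ(m).
    · have hΓm := Real.Gamma_pos_of_pos (p.m_pos i)
      have hΔ : 0 ≤ p.m i / p.spread i * p.ζ Γ i r ^ 2 :=
        mul_nonneg (div_pos (p.m_pos i) (p.spread_pos i)).le (sq_nonneg _)
      have hconv : IntegrableOn (fun t => t ^ (p.m i - 1) * Real.exp (-t)) (Set.Ioi 0) :=
        (Real.GammaIntegral_convergent (p.m_pos i)).congr_fun (fun t _ => mul_comm _ _)
          measurableSet_Ioi
      rw [sub_nonneg, div_le_one hΓm, Real.Gamma_eq_integral (p.m_pos i),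
        intervalIntegral.integral_of_le hΔ]
      simp_rw [mul_comm (Real.exp _)]
      refine setIntegral_mono_set hconv ?_ (Set.Ioc_subset_Ioi_self.eventuallyLE)
      filter_upwards [ae_restrict_mem measurableSet_Ioi] with t ht
      have ht : 0 < t := ht
      simp only [Pi.zero_apply]
      positivity
  rw [← hnak, servingDensity, linkDensity, fbar, f, stateProbHor_b i hr, meanCountGain, meanCount,
    meanCount, neg_add, Real.exp_add]
  simp only [neg_mul]
  ring

end NetworkParams

/-! ### The coverage formula -/

theorem theorem1 (p : NetworkParams) {Ω : Type*} [MeasurableSpace Ω] (P : Measure Ω)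
    [IsProbabilityMeasure P] (pos : ℕ → Ω → EuclideanSpace ℝ (Fin 2))
    (state : ℕ → Ω → LinkState) (fading : ℕ → Ω → ℝ)
    (hnet : p.IsUAVNetwork P pos state fading) (Γ : ℝ) (hΓ : 0 ≤ Γ) :
    (∀ᵐ ω ∂P, ∃! n, p.IsServing pos state n ω) ∧
    (∀ i, IntegrableOn (fun r =>
        (1 - (∫ t in (0 : ℝ)..p.Δ Γ i r, t ^ (p.m i - 1) * Real.exp (-t)) /
          Real.Gamma (p.m i)) * p.fbar i r) (Set.Ioi p.h)) ∧
    p.coverageProb pos state fading P Γ =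
      ∑ i, ∫ r in Set.Ioi p.h,
        (1 - (∫ t in (0 : ℝ)..p.Δ Γ i r, t ^ (p.m i - 1) * Real.exp (-t)) /
          Real.Gamma (p.m i)) * p.fbar i r := by
  have hz : ∀ i, Measurable (p.ζ Γ i) := NetworkParams.measurable_ζ Γ
  have hcongr : ∀ i, Set.EqOn (p.servingDensity (p.ζ Γ i) i) (fun r =>
      (1 - (∫ t in (0 : ℝ)..p.Δ Γ i r, t ^ (p.m i - 1) * Real.exp (-t)) /
        Real.Gamma (p.m i)) * p.fbar i r) (Set.Ioi p.h) := fun i r hr =>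
    (NetworkParams.mul_fbar_eq_servingDensity hΓ i (le_of_lt hr)).symm
  refine ⟨?_, fun i => ?_, ?_⟩
  · filter_upwards [hnet.ae_exists_isServing, hnet.ae_isServing_unique] with ω ⟨n, hn⟩ huniq
    exact ⟨n, hn, fun k hk => huniq k n hk hn⟩
  · exact (hnet.integrableOn_servingDensity (hz i) i).congr_fun (hcongr i) measurableSet_Ioi
  · have hsum : ∀ i, ∫ r in Set.Ioi p.h,
        (1 - (∫ t in (0 : ℝ)..p.Δ Γ i r, t ^ (p.m i - 1) * Real.exp (-t)) /
          Real.Gamma (p.m i)) * p.fbar i r =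
        P.real (⋃ N : ℕ, p.servingEvent pos state fading (p.ζ Γ i) i p.h (p.h + N)) := fun i => by
      rw [hnet.measureReal_iUnion_servingEvent (hz i) i,
        setIntegral_congr_fun measurableSet_Ioi (hcongr i)]
    simp_rw [hsum]
    -- Up to a null set, `E i` is coverage by a serving UAV in state i; uniqueness makes the two
    -- cases almost surely exclusive, so their probabilities add.
    set E : LinkState → Set Ω := fun i =>
      ⋃ N : ℕ, p.servingEvent pos state fading (p.ζ Γ i) i p.h (p.h + N) with hE
    have hEm : ∀ i, MeasurableSet (E i) := fun i =>
      .iUnion fun N => hnet.measurableSet_servingEvent (hz i) i _ _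
    have hdisj : AEDisjoint P (E .los) (E LinkState.los.opp) := by
      refine measure_eq_zero_iff_ae_notMem.2 ?_
      filter_upwards [hnet.ae_isServing_unique] with ω hω
      rintro ⟨h1, h2⟩
      obtain ⟨N, n, hn, hi, -⟩ := Set.mem_iUnion.1 h1
      obtain ⟨N', k, hk, hj, -⟩ := Set.mem_iUnion.1 h2
      rw [hω n k hn hk, hj] at hi
      exact LinkState.opp_ne _ hi
    rw [LinkState.sum_eq_add_opp _ .los,
      ← measureReal_union₀ (hEm _).nullMeasurableSet hdisj, NetworkParams.coverageProb]
    refine measureReal_congr ?_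
    filter_upwards [hnet.ae_h_lt_dist, hnet.ae_dist_pos] with ω hh hpos
    refine propext ⟨?_, ?_⟩
    · rintro ⟨n, hn, hsnr⟩
      obtain ⟨N, hN⟩ := exists_nat_ge (p.dist (pos n ω))
      have hmem : ω ∈ E (state n ω) := Set.mem_iUnion.2 ⟨N, n, hn, rfl,
        ⟨hh n, hN.trans (le_add_of_nonneg_left p.h_nonneg)⟩,
        (NetworkParams.lt_snr_iff (hpos n)).1 hsnr⟩
      rcases LinkState.eq_or_eq_opp .los (state n ω) with hs | hs
      · exact Or.inl (hs ▸ hmem)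
      · exact Or.inr (hs ▸ hmem)
    · have hback : ∀ i, ω ∈ E i → ∃ n, p.IsServing pos state n ω ∧
          Γ < p.snr pos state fading n ω := by
        intro i hi
        obtain ⟨N, n, hn, hs, -, hf⟩ := Set.mem_iUnion.1 hi
        refine ⟨n, hn, ?_⟩
        rw [NetworkParams.snr, NetworkParams.gainOf_eq n ω hs]
        exact (NetworkParams.lt_snr_iff (hpos n)).2 hf
      rintro (h | h)
      exacts [hback _ h, hback _ h]
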